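/- **Setting.** A polyhedron in $\mathbb{R}^n$ is a nonempty finite intersection of closed half-spaces. A vertex of a set $P$ is a point of $P$ that is the unique minimiser over $P$ of some linear functional; $V(P)$ is the set of vertices. For $p\in P$ let $N_P(p)=\{\ell\in(\mathbb{R}^n)^\star : \ell(p)\le\ell(x)\ \forall x\in P\}$, and let $N(P)=\bigcup_{p\in V(P)}N_P(p)$. A convex polyhedral cone in $(\mathbb{R}^n)^\star$ is a finite intersection of closed linear half-spaces; a cone is full-dimensional if it has nonempty interior; a facet of a cone is a face whose span has dimension $n-1$. Minkowski sum is denoted $\odot$, and $\oplus$ denotes the (closed) convex hull of the union. A polyhedral polynomial is $\phi=\bigoplus_{i\in S}Q_i\odot Y^i$ with $S=\mathrm{Supp}(\phi)\subset\mathbb{Z}_{\ge0}$ finite and nonempty and each $Q_i$ a polyhedron in $\mathbb{R}^n$. Put $\phi(P)=\bigoplus_{i\in S}Q_i\odot P^{\odot i}$ (with $P^{\odot 0}=\{0\}$) and $M=\bigodot_{i\in S}Q_i$. A solution to $\phi$ is a polyhedron $P$ with at least one vertex such that every vertex of $\phi(P)$ is a vertex of at least two summands $Q_l\odot P^{\odot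 l}$, $Q_m\odot P^{\odot m}$, $l\ne m$ in $S$. For a vertex $v$ of $M$, a solution $P$ is $v$-local if $N(P)\subseteq N_M(v)$; a $v$-local solution is Minkowski–Weyl minimal if its recession cone is minimal under inclusion among all $v$-local solutions with the same vertex set. Each vertex $v$ of $M$ is uniquely $v=\sum_{i\in S}v_i$ with $v_i\in V(Q_i)$. For distinct $i,j\in S$ put $\rho^{(v)}_{i,j}=-(v_i-v_j)/(i-j)$. The polynomial $\phi$ is generic if for every vertex $\nu$ of $M$, $\rho^{(\nu)}_{i,j}=\rho^{(\nu)}_{i',j'}$ implies $\{i,j\}=\{i',j'\}$. Fix a vertex $v$ of $M$. Consider the hyperplanes $\{\mu : \mu(u)=0\}$ in $(\mathbb{R}^n)^\star$, where $u$ runs over the nonzero vectors of the form $(v_k+k\rho^{(v)}_{i,j})-(v_i+i\rho^{(v)}_{i,j})$ or $\rho^{(v)}_{i,j}-\rho^{(v)}_{i',j'}$, with $i,j,k,i',j'\in S$, $i\ne j$, $i'\ne j'$. They subdivide $N_M(v)$ into a fan $\mathcal{F}_v$. A maximal cone $C$ of $\mathcal{F}_v$ has primary label $(i,j)$ if $\mu(v_i+i\rho^{(v)}_{i,j})\le\mu(v_k+k\rho^{(v)}_{i,j})$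 for all $k\in S$, $\mu\in C$, and secondary label $(i,j,i',j')$ if $\mu(\rho^{(v)}_{i,j})\le\mu(\rho^{(v)}_{i',j'})$ for all $\mu\in C$. A local compatible system at $v$ is a pair $(\mathcal{C},\mathcal{I})$, where $\mathcal{C}=\{C_1,\dots,C_t\}$ ($t\ge1$) consists of distinct maximal cones of $\mathcal{F}_v$ and $\mathcal{I}=\{(i_1,j_1),\dots,(i_t,j_t)\}$ is a corresponding collection of pairs of distinct elements of $S$, such that, with $\mathfrak{T}=\{\rho^{(v)}_{i_k,j_k}\}_{k=1}^t$: 1. for each $\gamma\in\mathfrak{T}$, $C_\gamma:=\bigcup_{k:\,\rho^{(v)}_{i_k,j_k}=\gamma}C_k$ is a convex polyhedral cone; 2. $(i_k,j_k)$ is a primary label of $C_k$ for each $k$; 3. $(i_\alpha,j_\alpha,i_\beta,j_\beta)$ is a secondary label of $C_\alpha$ for all $\alpha\ne\beta$; 4. if $\mathfrak{f}$ is a facet of exactly one cone $C_l$ among $C_1,\dots,C_t$ and also of a maximal cone $C\notin\mathcal{C}$ of $\mathcal{F}_v$, then either $(i_l,j_l)$ is not a primary label of $C$, or for some $\beta$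 the tuple $(i_l,j_l,i_\beta,j_\beta)$ is not a secondary label of $C$. For a convex polyhedral cone $L\subseteq\bigcup_kC_k$, the associated polyhedron of the restriction of $(\mathcal{C},\mathcal{I})$ to $L$ is the polyhedron whose vertices are those $\gamma\in\mathfrak{T}$ for which $C_\gamma\cap L$ is full-dimensional, each such $\gamma$ having normal cone $C_\gamma\cap L$. **Theorem.** Let $\phi$ be a generic polyhedral polynomial and $v$ a vertex of $M$. A polyhedron $P_0$ with vertex set $V$ is a Minkowski–Weyl minimal $v$-local solution to $\phi$ if and only if there is a local compatible system $(\mathcal{C},\mathcal{I})$ at $v$, with $\mathcal{C}=\{C_k\}_{k=1}^t$ and $\mathcal{I}=\{(i_k,j_k)\}_{k=1}^t$, such that $V=\{\rho^{(v)}_{i_k,j_k}\}_{k=1}^t$ and $P_0$ is the associated polyhedron of the restriction of $(\mathcal{C},\mathcal{I})$ to a convex polyhedral cone that is maximal under inclusion among the convex polyhedral cones contained in $\bigcup_{k=1}^tC_k$. -/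

import Mathlib

namespace Polyhedral

open scoped Pointwise

section Polyhedra

variable {E : Type*} [NormedAddCommGroup E] [NormedSpace ℝ E]

/-- A (nonempty) polyhedron: a finite intersection of closed half-spaces. -/
def IsPolyhedron (P : Set E) : Prop :=
  P.Nonempty ∧ ∃ A : Finset (StrongDual ℝ E × ℝ), P = {x | ∀ a ∈ A, a.2 ≤ a.1 x}

/-- A convex polyhedral cone in the dual space: a finite intersection of closed linear
half-spaces (which, in finite dimension, are given by vectors of `E`). -/
def IsPolyhedralCone (C : Set (StrongDual ℝ E)) : Prop :=
  ∃ T : Finset E, C = {μ | ∀ x ∈ T, 0 ≤ μ x}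

/-- The vertices of `P`: points that are the unique minimiser over `P` of a linear functional. -/
def vertexSet (P : Set E) : Set E :=
  {p | p ∈ P ∧ ∃ ℓ : StrongDual ℝ E, ∀ x ∈ P, x ≠ p → ℓ p < ℓ x}

/-- The inner normal cone of `p` in `P`: the functionals minimised over `P` at `p`. -/
def normalCone (P : Set E) (p : E) : Set (StrongDual ℝ E) :=
  {ℓ | ∀ x ∈ P, ℓ p ≤ ℓ x}

/-- The inner normal cone `N(P)` of `P` (the support of its inner normal fan): the union of
the inner normal cones of all its vertices. -/
def normalSupport (P : Set E) : Set (StrongDual ℝ E) :=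
  ⋃ p ∈ vertexSet P, normalCone P p

/-- The recession cone (Minkowski-Weyl cone) of `P`. -/
def recessionCone (P : Set E) : Set E :=
  {u | ∀ x ∈ P, ∀ s : ℝ, 0 ≤ s → x + s • u ∈ P}

/-- A cone in the dual space is full-dimensional if it has nonempty interior. -/
def IsFullDimensional (C : Set (StrongDual ℝ E)) : Prop :=
  (interior C).Nonempty

/-- `f` is a facet of the cone `C`: a face, cut out by a supporting hyperplane, of
codimension one in the ambient space. -/
def IsFacet (C f : Set (StrongDual ℝ E)) : Prop :=
  (∃ x : E, (∀ μ ∈ C, 0 ≤ μ x) ∧ f = {μ ∈ C | μ x = 0}) ∧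
    Module.finrank ℝ (Submodule.span ℝ f) + 1 = Module.finrank ℝ E

end Polyhedra

/-- A nonzero polyhedral polynomial `⊕_{i ∈ supp} Q_i ⊙ Y^i` in one variable. The values of
`coeff` outside `supp` play no role. -/
structure PolyhedralPolynomial (E : Type*) [NormedAddCommGroup E] [NormedSpace ℝ E] where
  supp : Finset ℕ
  supp_nonempty : supp.Nonempty
  coeff : ℕ → Set E
  isPolyhedron_coeff : ∀ i ∈ supp, IsPolyhedron (coeff i)

namespace PolyhedralPolynomial

variable {E : Type*} [NormedAddCommGroup E] [NormedSpace ℝ E] (φ : PolyhedralPolynomial E)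

/-- The `i`-th summand `Q_i ⊙ P^{⊙ i}` of the evaluation at `P`: the Minkowski sum of `Q_i`
and `i` copies of `P` (an empty Minkowski sum is `{0}`). -/
def summand (i : ℕ) (P : Set E) : Set E :=
  φ.coeff i + ∑ _k ∈ Finset.range i, P

/-- The evaluation `φ(P)`: the convex hull of the summands. The closure makes the convex hull
of polyhedra with different recession cones a polyhedron. -/
def eval (P : Set E) : Set E :=
  closure (convexHull ℝ (⋃ i ∈ φ.supp, φ.summand i P))

/-- `P`, a polyhedron having a vertex, is a solution to `φ`: every vertex of `φ(P)` is a vertex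
of at least two distinct summands. -/
def IsSolution (P : Set E) : Prop :=
  IsPolyhedron P ∧ (vertexSet P).Nonempty ∧
    ∀ w ∈ vertexSet (φ.eval P), ∃ l ∈ φ.supp, ∃ m ∈ φ.supp, l ≠ m ∧
      w ∈ vertexSet (φ.summand l P) ∧ w ∈ vertexSet (φ.summand m P)

/-- The Minkowski sum `M` of the coefficients. -/
def coeffSum : Set E :=
  ∑ i ∈ φ.supp, φ.coeff i

/-- `P` is a `v`-local solution. -/
def IsLocalSolution (v : E) (P : Set E) : Prop :=
  φ.IsSolution P ∧ normalSupport P ⊆ normalCone φ.coeffSum v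

/-- `P` is a Minkowski-Weyl minimal `v`-local solution: its recession cone is minimal under
inclusion among all `v`-local solutions with the same vertex set. -/
def IsMinimalLocalSolution (v : E) (P : Set E) : Prop :=
  φ.IsLocalSolution v P ∧
    ∀ P' : Set E, φ.IsLocalSolution v P' → vertexSet P' = vertexSet P →
      recessionCone P' ⊆ recessionCone P → recessionCone P' = recessionCone P

/-- `d` is a Minkowski decomposition of `v`: each `d i` is a vertex of `Q_i` and their sum
is `v`. -/
def IsDecomposition (v : E) (d : ℕ → E) : Prop :=
  (∀ i ∈ φ.supp, d i ∈ vertexSet (φ.coeff i)) ∧ ∑ i ∈ φ.supp, d i = v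

/-- The component `v_i` of the Minkowski decomposition of a vertex `v` of `M`. -/
noncomputable def component (v : E) : ℕ → E :=
  Classical.epsilon (φ.IsDecomposition v)

theorem eq_of_sum_eq_vertex {v : E} (hv : v ∈ vertexSet φ.coeffSum) {d : ℕ → E}
    (hd : ∀ i ∈ φ.supp, d i ∈ φ.coeff i) (hs : ∑ i ∈ φ.supp, d i = v) :
    ∃ ℓ : StrongDual ℝ E, ∀ i ∈ φ.supp, ∀ x ∈ φ.coeff i, x ≠ d i → ℓ (d i) < ℓ x := by
  obtain ⟨-, ℓ, hℓ⟩ := hv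
  refine ⟨ℓ, fun i hi x hx hne => ?_⟩
  have hsum : ∑ k ∈ φ.supp, Function.update d i x k = v - d i + x := by
    rw [Finset.sum_update_of_mem hi, ← hs, ← Finset.add_sum_erase _ _ hi,
      Finset.sdiff_singleton_eq_erase]
    abel
  have hmem : ∑ k ∈ φ.supp, Function.update d i x k ∈ φ.coeffSum := by
    refine Set.mem_finsetSum (t := φ.supp) (f := φ.coeff) _ |>.2
      ⟨Function.update d i x, fun {k} hk => ?_, rfl⟩
    by_cases h : k = i
    · subst h; simpa using hx
    · simpa [h] using hd k hk
  have := hℓ _ hmem (by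
    rw [hsum]
    intro h
    apply hne
    have h2 : x - d i = 0 := by
      have : v - d i + x - v = 0 := by rw [h, sub_self]
      rw [← this]; abel
    exact sub_eq_zero.1 h2)
  rw [hsum] at this
  simp only [map_add, map_sub] at this
  linarith

/-- The Minkowski decomposition of a vertex exists, so `component` is one. -/
theorem isDecomposition_component {v : E} (hv : v ∈ vertexSet φ.coeffSum) :
    φ.IsDecomposition v (φ.component v) := by
  refine Classical.epsilon_spec (p := φ.IsDecomposition v) ?_
  obtain ⟨d, hd, hs⟩ := (Set.mem_finsetSum (t := φ.supp) (f := φ.coeff) v).1 hv.1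
  obtain ⟨ℓ, hℓ⟩ := φ.eq_of_sum_eq_vertex hv (fun i hi => hd hi) hs
  exact ⟨d, fun i hi => ⟨hd hi, ℓ, hℓ i hi⟩, hs⟩

/-- The Minkowski decomposition of a vertex is unique. -/
theorem IsDecomposition.eq_component {v : E} (hv : v ∈ vertexSet φ.coeffSum) {d : ℕ → E}
    (hd : φ.IsDecomposition v d) : ∀ i ∈ φ.supp, d i = φ.component v i := by
  obtain ⟨hc, hcs⟩ := φ.isDecomposition_component hv
  obtain ⟨ℓ, hℓ⟩ := φ.eq_of_sum_eq_vertex hv (fun i hi => (hd.1 i hi).1) hd.2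
  by_contra! hne
  obtain ⟨i, hi, hne⟩ := hne
  have hlt : ∑ k ∈ φ.supp, ℓ (d k) < ∑ k ∈ φ.supp, ℓ (φ.component v k) := by
    refine Finset.sum_lt_sum (fun k hk => ?_) ⟨i, hi, hℓ i hi _ (hc i hi).1 hne.symm⟩
    by_cases h : φ.component v k = d k
    · rw [h]
    · exact (hℓ k hk _ (hc k hk).1 h).le
  rw [← map_sum, ← map_sum, hd.2, hcs] at hlt
  exact lt_irrefl _ hlt

/-- The point `ρ^{(v)}_{i,j} = -(v_i - v_j) / (i - j)`. -/
noncomputable def rho (v : E) (i j : ℕ) : E :=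
  -(((i : ℝ) - (j : ℝ))⁻¹ • (φ.component v i - φ.component v j))

/-- For every vertex `ν` of `M` the points `ρ^{(ν)}_{i,j}` are distinct for distinct unordered
pairs of indices. -/
def IsGeneric : Prop :=
  ∀ ν ∈ vertexSet φ.coeffSum, ∀ i ∈ φ.supp, ∀ j ∈ φ.supp, ∀ i' ∈ φ.supp, ∀ j' ∈ φ.supp,
    i ≠ j → i' ≠ j' → φ.rho ν i j = φ.rho ν i' j' → ({i, j} : Set ℕ) = {i', j'}

/-- The point `v_k + k ρ^{(v)}_{i,j}`. -/
noncomputable def shifted (v : E) (i j k : ℕ) : E :=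
  φ.component v k + (k : ℝ) • φ.rho v i j

/-- Normal vectors of the non-degenerate hyperplanes of both families: a vector `u` in this set
stands for the hyperplane `{μ | μ u = 0}`. -/
def arrangementNormals (v : E) : Set E :=
  {u | u ≠ 0 ∧
    ((∃ i ∈ φ.supp, ∃ j ∈ φ.supp, ∃ k ∈ φ.supp, i ≠ j ∧
        u = φ.shifted v i j k - φ.shifted v i j i) ∨
      (∃ i ∈ φ.supp, ∃ j ∈ φ.supp, ∃ i' ∈ φ.supp, ∃ j' ∈ φ.supp, i ≠ j ∧ i' ≠ j' ∧
        u = φ.rho v i j - φ.rho v i' j'))}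

/-- The maximal cones of the fan `𝓕_v`, the restriction of the hyperplane arrangement to the
normal cone `N_M(v)`: for a point `μ₀` in the interior of `N_M(v)` off all hyperplanes, the
set of points of `N_M(v)` weakly on the same side as `μ₀` of each hyperplane. -/
def maximalCones (v : E) : Set (Set (StrongDual ℝ E)) :=
  {C | ∃ μ₀ ∈ interior (normalCone φ.coeffSum v),
    (∀ u ∈ φ.arrangementNormals v, μ₀ u ≠ 0) ∧
    C = {μ ∈ normalCone φ.coeffSum v | ∀ u ∈ φ.arrangementNormals v, 0 ≤ μ₀ u * μ u}}

/-- The cone `C` has `(i, j)` as a primary label. -/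
def HasPrimaryLabel (v : E) (C : Set (StrongDual ℝ E)) (i j : ℕ) : Prop :=
  ∀ k ∈ φ.supp, ∀ μ ∈ C, μ (φ.shifted v i j i) ≤ μ (φ.shifted v i j k)

/-- The cone `C` has `(i, j, i', j')` as a secondary label. -/
def HasSecondaryLabel (v : E) (C : Set (StrongDual ℝ E)) (i j i' j' : ℕ) : Prop :=
  ∀ μ ∈ C, μ (φ.rho v i j) ≤ μ (φ.rho v i' j')

/-- The union `C_γ` of those cones `C_k` for which `ρ^{(v)}_{i_k,j_k} = γ`. -/
def coneAt (v : E) {t : ℕ} (C : Fin t → Set (StrongDual ℝ E)) (i j : Fin t → ℕ) (γ : E) :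
    Set (StrongDual ℝ E) :=
  ⋃ (k : Fin t) (_ : φ.rho v (i k) (j k) = γ), C k

/-- The cones `C_1, …, C_t` together with the pairs `(i_1, j_1), …, (i_t, j_t)` form a local
compatible system of `φ` at `v`. -/
structure IsLocalCompatibleSystem (v : E) {t : ℕ} (C : Fin t → Set (StrongDual ℝ E))
    (i j : Fin t → ℕ) : Prop where
  pos : 0 < t
  injective : Function.Injective C
  mem_maximalCones : ∀ k, C k ∈ φ.maximalCones v
  left_mem : ∀ k, i k ∈ φ.supp
  right_mem : ∀ k, j k ∈ φ.supp
  ne : ∀ k, i k ≠ j k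
  isPolyhedralCone_coneAt : ∀ k, IsPolyhedralCone (φ.coneAt v C i j (φ.rho v (i k) (j k)))
  primary : ∀ k, φ.HasPrimaryLabel v (C k) (i k) (j k)
  secondary : ∀ α β, α ≠ β → φ.HasSecondaryLabel v (C α) (i α) (j α) (i β) (j β)
  boundary : ∀ (l : Fin t) (f : Set (StrongDual ℝ E)),
    IsFacet (C l) f → (∀ k, IsFacet (C k) f → k = l) →
    ∀ D ∈ φ.maximalCones v, D ∉ Set.range C → IsFacet D f →
      ¬ φ.HasPrimaryLabel v D (i l) (j l) ∨
        ∃ β, ¬ φ.HasSecondaryLabel v D (i l) (j l) (i β) (j β)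

/-- `L` is a maximal polyhedral convex subset (cone) of the set `U`. -/
def IsMaximalPolyhedralSubcone (U L : Set (StrongDual ℝ E)) : Prop :=
  Maximal (fun K => IsPolyhedralCone K ∧ K ⊆ U) L

/-- `P` is the associated polyhedron of the restriction to `L` of the system: its vertices are
the points `γ = ρ^{(v)}_{i_k,j_k}` for which `C_γ ∩ L` is full-dimensional, and the normal cone
of such a vertex `γ` is `C_γ ∩ L`. -/
def IsAssociatedPolyhedron (v : E) {t : ℕ} (C : Fin t → Set (StrongDual ℝ E))
    (i j : Fin t → ℕ) (L : Set (StrongDual ℝ E)) (P : Set E) : Prop :=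
  IsPolyhedron P ∧
    vertexSet P = {γ | γ ∈ Set.range (fun k => φ.rho v (i k) (j k)) ∧
      IsFullDimensional (φ.coneAt v C i j γ ∩ L)} ∧
    ∀ γ ∈ vertexSet P, normalCone P γ = φ.coneAt v C i j γ ∩ L

end PolyhedralPolynomial

end Polyhedral

/-!
A polyhedron with a vertex attains its minimum, for a functional nonnegative on its recession cone,
at a vertex (`IsPolyhedron.mem_normalSupport_iff`). So its normal support `N(P)` is the dual of its
recession cone, and minimality of the recession cone is maximality of `N(P)`.

Let `P` be a polyhedron with vertex set `V` and `N(P) ⊆ N_M(v)`. A functional interior to the normal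
cone of `γ ∈ V` is minimised over the summand `Q_k ⊙ P^k` at `v_k + k γ`. A vertex of `φ(P)` exposed by it is
therefore a vertex of two summands `l ≠ m` only if `v_l + l γ = v_m + m γ`, that is `γ = ρ_{l,m}`,
and this common point is least among all `v_k + k γ`. Hence `P` is a `v`-local solution if and only
if every `γ ∈ V` is some `ρ_{l,m}` and its normal cone lies in `cell v V γ`, the cone on which `γ` is
least in `V` and the primary inequalities of `(l, m)` hold; by genericity `(l, m)` is determined by
`γ` up to order. The two directions are `IsLocalSolution.normalCone_subset_cell` and
`isLocalSolution_of_normalCone_subset_cell`. Conversely every polyhedral cone between `N(P)` and the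
union of the cells is the normal support of a local solution with the same vertices
(`IsLocalSolution.exists_normalSupport_eq`, from `exists_isPolyhedron_normalCone_eq`). The minimal
local solutions with vertex set `V` thus correspond to the maximal polyhedral cones in the union
of the cells that meet every cell in a full-dimensional cone.

It remains to see that compatible systems encode the cells. The cells are cut out of `N_M(v)` by
hyperplanes of the arrangement, so a full-dimensional one is a union of maximal cones of the fan, and
all maximal cones in the cells form a compatible system (`exists_isLocalCompatibleSystem`). In any
compatible system the cones with point `γ` lie in the cell of `γ`; if they did not fill it, a generic
segment in the cell would leave them through a wall, and the maximal cone behind the wall would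
violate the boundary condition (`IsLocalCompatibleSystem.coneAt_eq_cell`).
-/

namespace Polyhedral

open scoped Pointwise

/-! ### Cones cut out by finitely many inequalities -/

section Generators

variable {W : Type*} [AddCommGroup W] [Module ℝ W]

/-- The Minkowski–Weyl theorem for cones, in dual form: for the cone `K` cut out by finitely many
linear inequalities there are finitely many vectors of `K` that test whether a functional is
nonnegative on `K`. Induction over the inequalities by Fourier–Motzkin elimination. -/
theorem exists_finset_test_vectors [FiniteDimensional ℝ W] (F : Finset (W →ₗ[ℝ] ℝ)) :
    ∃ G : Finset W, (∀ g ∈ G, ∀ f ∈ F, 0 ≤ f g) ∧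
      ∀ ℓ : W →ₗ[ℝ] ℝ, (∀ g ∈ G, 0 ≤ ℓ g) → ∀ x, (∀ f ∈ F, 0 ≤ f x) → 0 ≤ ℓ x := by
  classical
  induction F using Finset.induction_on with
  | empty =>
    let b := Module.finBasis ℝ W
    refine ⟨Finset.univ.image b ∪ Finset.univ.image (fun i => -b i), by simp, ?_⟩
    intro ℓ hℓ x _
    have h0 : ℓ = 0 := b.ext fun i => by
      have h1 := hℓ (b i) (by simp)
      have h2 := hℓ (-b i) (by simp)
      rw [map_neg] at h2
      simpa using le_antisymm (by linarith) h1
    simp [h0]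
  | insert f F _ ih =>
    obtain ⟨G, hG, hdual⟩ := ih
    let G₀ := G.filter fun g => 0 ≤ f g
    let G₁ := (G ×ˢ G).filter fun p => 0 ≤ f p.1 ∧ f p.2 < 0
    refine ⟨G₀ ∪ G₁.image fun p => f p.1 • p.2 - f p.2 • p.1, ?_, ?_⟩
    · intro g hg f' hf'
      rcases Finset.mem_union.1 hg with hg | hg
      · obtain ⟨hgG, hfg⟩ := Finset.mem_filter.1 hg
        rcases Finset.mem_insert.1 hf' with rfl | hf'
        exacts [hfg, hG g hgG f' hf']
      · obtain ⟨⟨p, q⟩, hpq, rfl⟩ := Finset.mem_image.1 hg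
        obtain ⟨hmem, hp, hq⟩ := Finset.mem_filter.1 hpq
        obtain ⟨hpG, hqG⟩ := Finset.mem_product.1 hmem
        simp only [map_sub, map_smul, smul_eq_mul]
        rcases Finset.mem_insert.1 hf' with rfl | hf'
        · linarith
        · have h1 := hG p hpG f' hf'
          have h2 := hG q hqG f' hf'
          simp only at hp hq
          nlinarith [mul_nonneg hp h2, mul_nonneg (neg_nonneg.2 hq.le) h1]
    · intro ℓ hℓ x hx
      have hx0 : 0 ≤ f x := hx f (Finset.mem_insert_self _ _)
      have hxF : ∀ f' ∈ F, 0 ≤ f' x := fun f' hf' => hx f' (Finset.mem_insert_of_mem hf')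
      have hpos : ∀ g ∈ G, 0 ≤ f g → 0 ≤ ℓ g := fun g hg hfg =>
        hℓ g (Finset.mem_union_left _ (Finset.mem_filter.2 ⟨hg, hfg⟩))
      have hmix : ∀ g ∈ G, ∀ h ∈ G, 0 ≤ f g → f h < 0 → 0 ≤ f g * ℓ h - f h * ℓ g := by
        intro g hg h hh hfg hfh
        have := hℓ (f g • h - f h • g) (Finset.mem_union_right _
          (Finset.mem_image.2 ⟨(g, h), Finset.mem_filter.2
            ⟨Finset.mem_product.2 ⟨hg, hh⟩, hfg, hfh⟩, rfl⟩))
        simpa using this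
      -- A multiple `c ≥ 0` of `f` with `ℓ - c f ≥ 0` on `G` reduces the claim to `F`.
      suffices ∃ c : ℝ, 0 ≤ c ∧ ∀ g ∈ G, c * f g ≤ ℓ g by
        obtain ⟨c, hc, hcG⟩ := this
        have := hdual (ℓ - c • f) (fun g hg => by simpa using hcG g hg) x hxF
        simp only [LinearMap.sub_apply, LinearMap.smul_apply, smul_eq_mul] at this
        nlinarith [mul_nonneg hc hx0]
      by_cases hneg : ∃ h ∈ G, f h < 0 ∧ ℓ h < 0
      · obtain ⟨h₀, hh₀, hmax⟩ := Finset.exists_max_image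
          (G.filter fun h => f h < 0) (fun h => ℓ h / f h)
          (by obtain ⟨h, hh, h1, -⟩ := hneg; exact ⟨h, Finset.mem_filter.2 ⟨hh, h1⟩⟩)
        obtain ⟨hh₀G, hfh₀⟩ := Finset.mem_filter.1 hh₀
        refine ⟨ℓ h₀ / f h₀, ?_, fun g hg => ?_⟩
        · obtain ⟨h, hh, h1, h2⟩ := hneg
          exact (div_pos_of_neg_of_neg h2 h1).le.trans (hmax h (Finset.mem_filter.2 ⟨hh, h1⟩))
        · rcases le_or_gt 0 (f g) with hfg | hfg
          · have := hmix g hg h₀ hh₀G hfg hfh₀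
            rw [div_mul_eq_mul_div, div_le_iff_of_neg hfh₀]
            linarith
          · have := hmax g (Finset.mem_filter.2 ⟨hg, hfg⟩)
            rw [div_le_iff_of_neg hfg] at this
            exact this
      · push Not at hneg
        refine ⟨0, le_rfl, fun g hg => ?_⟩
        rw [zero_mul]
        rcases le_or_gt 0 (f g) with hfg | hfg
        exacts [hpos g hg hfg, hneg g hg hfg]

end Generators

variable {E : Type*} [NormedAddCommGroup E] [NormedSpace ℝ E]

/-! ### Normal cones -/

/-- A functional interior to the normal cone of `w` is minimised only at `w`: a tie with `x` would be
broken in favour of `x` by a nearby functional. No polyhedrality is needed. -/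
theorem apply_lt_of_mem_interior_normalCone {X : Set E} {w : E} {ℓ : StrongDual ℝ E}
    (hℓ : ℓ ∈ interior (normalCone X w)) {x : E} (hx : x ∈ X) (hne : x ≠ w) : ℓ w < ℓ x := by
  obtain ⟨f, -, hf⟩ := exists_dual_vector ℝ (x - w) (norm_ne_zero_iff.2 (sub_ne_zero.2 hne))
  have hfpos : 0 < f (x - w) := by
    rw [hf]; simpa [sub_eq_zero] using hne
  have hev : ∀ᶠ s : ℝ in nhdsWithin 0 (Set.Ioi 0), ℓ - s • f ∈ normalCone X w := by
    have hc : Filter.Tendsto (fun s : ℝ => ℓ - s • f) (nhds 0) (nhds ℓ) := by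
      have : Continuous fun s : ℝ => ℓ - s • f := by fun_prop
      simpa using this.tendsto 0
    exact (hc.eventually (mem_interior_iff_mem_nhds.1 hℓ)).filter_mono nhdsWithin_le_nhds
  obtain ⟨s, hs, hs0⟩ := (hev.and self_mem_nhdsWithin).exists
  have h := hs x hx
  have hs0 : 0 < s := hs0
  simp only [sub_apply, smul_apply, smul_eq_mul] at h
  rw [map_sub] at hfpos
  nlinarith [mul_pos hs0 hfpos]

theorem isClosed_normalCone (X : Set E) (w : E) : IsClosed (normalCone X w) := by
  have : normalCone X w = ⋂ x ∈ X, {ℓ : StrongDual ℝ E | ℓ w ≤ ℓ x} := by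
    ext; simp [normalCone]
  rw [this]
  exact isClosed_biInter fun x _ =>
    isClosed_le (ContinuousLinearMap.apply ℝ ℝ w).continuous
      (ContinuousLinearMap.apply ℝ ℝ x).continuous

theorem convex_normalCone (X : Set E) (w : E) : Convex ℝ (normalCone X w) := by
  intro a ha b hb s t hs ht _ x hx
  have h1 := mul_le_mul_of_nonneg_left (ha x hx) hs
  have h2 := mul_le_mul_of_nonneg_left (hb x hx) ht
  simp only [add_apply, smul_apply, smul_eq_mul]
  linarith

theorem normalCone_subset_normalSupport {P : Set E} {p : E} (hp : p ∈ vertexSet P) :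
    normalCone P p ⊆ normalSupport P :=
  Set.subset_biUnion_of_mem (u := fun p => normalCone P p) hp

theorem IsPolyhedralCone.isClosed {C : Set (StrongDual ℝ E)} (hC : IsPolyhedralCone C) :
    IsClosed C := by
  obtain ⟨T, rfl⟩ := hC
  have : {μ : StrongDual ℝ E | ∀ x ∈ T, 0 ≤ μ x} =
      ⋂ x ∈ T, {μ : StrongDual ℝ E | 0 ≤ μ x} := by
    ext; simp
  rw [this]
  exact isClosed_biInter fun x _ =>
    isClosed_le continuous_const (ContinuousLinearMap.apply ℝ ℝ x).continuous

theorem IsPolyhedralCone.convex {C : Set (StrongDual ℝ E)} (hC : IsPolyhedralCone C) :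
    Convex ℝ C := by
  obtain ⟨T, rfl⟩ := hC
  intro a ha b hb s t hs ht _ x hx
  simpa using add_nonneg (mul_nonneg hs (ha x hx)) (mul_nonneg ht (hb x hx))

theorem IsPolyhedralCone.inter {C D : Set (StrongDual ℝ E)} (hC : IsPolyhedralCone C)
    (hD : IsPolyhedralCone D) : IsPolyhedralCone (C ∩ D) := by
  classical
  obtain ⟨T, rfl⟩ := hC
  obtain ⟨T', rfl⟩ := hD
  refine ⟨T ∪ T', ?_⟩
  ext μ
  simp only [Set.mem_inter_iff, Set.mem_ofPred_eq, Finset.mem_union]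
  exact ⟨fun h x hx => hx.elim (h.1 x) (h.2 x), fun h => ⟨fun x hx => h x (.inl hx),
    fun x hx => h x (.inr hx)⟩⟩

theorem isPolyhedralCone_of_finite {T : Set E} (hT : T.Finite) :
    IsPolyhedralCone {μ : StrongDual ℝ E | ∀ x ∈ T, 0 ≤ μ x} :=
  ⟨hT.toFinset, by simp⟩

theorem isPolyhedralCone_setOf_le {K : Set (StrongDual ℝ E)} (hK : IsPolyhedralCone K) {V : Set E}
    (hV : V.Finite) (γ : E) : IsPolyhedralCone {μ ∈ K | ∀ γ' ∈ V, μ γ ≤ μ γ'} := by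
  convert hK.inter (isPolyhedralCone_of_finite (hV.image fun γ' => γ' - γ)) using 1
  ext μ
  simp

theorem isPolyhedralCone_biInter {ι : Type*} (s : Finset ι) (C : ι → Set (StrongDual ℝ E))
    (hC : ∀ i ∈ s, IsPolyhedralCone (C i)) : IsPolyhedralCone (⋂ i ∈ s, C i) := by
  classical
  induction s using Finset.induction_on with
  | empty => exact ⟨∅, by simp⟩
  | insert i s _ ih =>
    rw [Finset.set_biInter_insert]
    exact (hC i (Finset.mem_insert_self _ _)).inter
      (ih fun k hk => hC k (Finset.mem_insert_of_mem hk))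

/-- The dual of a cone cut out by finitely many linear inequalities is polyhedral. -/
theorem isPolyhedralCone_dual [FiniteDimensional ℝ E] (A : Finset (StrongDual ℝ E)) :
    IsPolyhedralCone {μ : StrongDual ℝ E | ∀ u, (∀ a ∈ A, 0 ≤ a u) → 0 ≤ μ u} := by
  classical
  obtain ⟨G, hG, hdual⟩ := exists_finset_test_vectors
    (A.image fun a : StrongDual ℝ E => (a : E →ₗ[ℝ] ℝ))
  refine ⟨G, Set.Subset.antisymm (fun μ hμ g hg => hμ g fun a ha => ?_)
    (fun μ hμ u hu => hdual μ hμ u ?_)⟩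
  · exact hG g hg _ (Finset.mem_image_of_mem _ ha)
  · intro f hf
    obtain ⟨a, ha, rfl⟩ := Finset.mem_image.1 hf
    exact hu a ha

/-! ### Polyhedra -/

/-- A small enough step in a direction that no active constraint forbids stays in the
polyhedron. -/
theorem exists_pos_add_smul_mem (A : Finset (StrongDual ℝ E × ℝ)) {p u : E}
    (hp : ∀ a ∈ A, a.2 ≤ a.1 p) (hu : ∀ a ∈ A, a.1 p = a.2 → 0 ≤ a.1 u) :
    ∃ s : ℝ, 0 < s ∧ ∀ a ∈ A, a.2 ≤ a.1 (p + s • u) := by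
  have hev : ∀ᶠ s : ℝ in nhdsWithin 0 (Set.Ioi 0), ∀ a ∈ A, a.2 ≤ a.1 (p + s • u) := by
    rw [Filter.eventually_all_finset]
    intro a ha
    rcases (hp a ha).eq_or_lt with h | h
    · filter_upwards [self_mem_nhdsWithin] with s hs
      have hs : 0 < s := hs
      simpa [h] using mul_nonneg hs.le (hu a ha h.symm)
    · have hc : Continuous fun s : ℝ => a.1 (p + s • u) := by fun_prop
      have := (hc.tendsto 0).eventually (lt_mem_nhds (a := a.2) (by simpa using h))
      exact (this.mono fun _ h => h.le).filter_mono nhdsWithin_le_nhds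
  obtain ⟨s, hs, hs0⟩ := (hev.and self_mem_nhdsWithin).exists
  exact ⟨s, hs0, hs⟩

theorem mem_recessionCone_iff {P : Set E} (hP : P.Nonempty) {A : Finset (StrongDual ℝ E × ℝ)}
    (hA : P = {x | ∀ a ∈ A, a.2 ≤ a.1 x}) {u : E} :
    u ∈ recessionCone P ↔ ∀ a ∈ A, 0 ≤ a.1 u := by
  subst hA
  constructor
  · intro h a ha
    obtain ⟨x, hx⟩ := hP
    by_contra! hneg
    have hs : 0 ≤ (a.1 x - a.2 + 1) / (-a.1 u) :=
      div_nonneg (by linarith [hx a ha]) (by linarith)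
    have := h x hx _ hs a ha
    have h2 : (a.1 x - a.2 + 1) / (-a.1 u) * a.1 u = -(a.1 x - a.2 + 1) := by
      have := hneg.ne
      field_simp
    simp only [map_add, map_smul, smul_eq_mul, h2] at this
    linarith
  · intro h x hx s hs a ha
    have := hx a ha
    simpa using add_le_add this (mul_nonneg hs (h a ha))

/-- From any point of a pointed polyhedron one reaches, without increasing a functional that is
nonnegative on the recession cone, a point whose active constraints have trivial common kernel:
as long as they do not, there is a direction along them in which a further constraint becomes
active. -/
theorem exists_basic_le (A : Finset (StrongDual ℝ E × ℝ))
    (hA : ∀ u, (∀ a ∈ A, a.1 u = 0) → u = 0) {μ : StrongDual ℝ E}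
    (hμ : ∀ u, (∀ a ∈ A, 0 ≤ a.1 u) → 0 ≤ μ u) {x : E} (hx : ∀ a ∈ A, a.2 ≤ a.1 x) :
    ∃ y, (∀ a ∈ A, a.2 ≤ a.1 y) ∧ μ y ≤ μ x ∧
      ∀ u, (∀ a ∈ A, a.1 y = a.2 → a.1 u = 0) → u = 0 := by
  classical
  induction hn : (A.filter fun a => a.1 x ≠ a.2).card using Nat.strong_induction_on
    generalizing x with
  | _ n ih =>
    by_cases hbasic : ∀ u, (∀ a ∈ A, a.1 x = a.2 → a.1 u = 0) → u = 0
    · exact ⟨x, hx, le_rfl, hbasic⟩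
    push Not at hbasic
    obtain ⟨u₀, hu₀, hne⟩ := hbasic
    -- Orient the direction so that `μ` does not increase and some constraint decreases.
    obtain ⟨u, hu, hμu, c, hcA, hcu⟩ : ∃ u, (∀ a ∈ A, a.1 x = a.2 → a.1 u = 0) ∧ μ u ≤ 0 ∧
        ∃ c ∈ A, c.1 u < 0 := by
      have hneg : ∀ u, μ u < 0 → ∃ c ∈ A, c.1 u < 0 := by
        intro u h
        by_contra! hcon
        exact absurd (hμ u hcon) h.not_ge
      rcases lt_trichotomy (μ u₀) 0 with h | h | h
      · exact ⟨u₀, hu₀, h.le, hneg _ h⟩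
      · obtain ⟨c, hc, hcu⟩ : ∃ c ∈ A, c.1 u₀ ≠ 0 := by
          by_contra! hcon
          exact hne (hA u₀ hcon)
        rcases hcu.lt_or_gt with h' | h'
        · exact ⟨u₀, hu₀, h.le, c, hc, h'⟩
        · exact ⟨-u₀, fun a ha hax => by simp [hu₀ a ha hax], by simp [h], c, hc, by simpa⟩
      · exact ⟨-u₀, fun a ha hax => by simp [hu₀ a ha hax], by simpa using h.le,
          hneg _ (by simpa)⟩
    obtain ⟨d, hd, hmin⟩ := Finset.exists_min_image (A.filter fun a => a.1 u < 0)
      (fun a => (a.1 x - a.2) / (-a.1 u)) ⟨c, Finset.mem_filter.2 ⟨hcA, hcu⟩⟩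
    obtain ⟨hdA, hdu⟩ := Finset.mem_filter.1 hd
    set s := (d.1 x - d.2) / (-d.1 u) with hs
    have hs0 : 0 ≤ s := div_nonneg (by linarith [hx d hdA]) (by linarith)
    have hdx : d.1 x ≠ d.2 := fun h => hdu.ne (hu d hdA h)
    have hds : d.1 (x + s • u) = d.2 := by
      have : s * d.1 u = -(d.1 x - d.2) := by
        have := hdu.ne
        rw [hs]; field_simp
      simp only [map_add, map_smul, smul_eq_mul, this]
      ring
    have hy : ∀ a ∈ A, a.2 ≤ a.1 (x + s • u) := by
      intro a ha
      simp only [map_add, map_smul, smul_eq_mul]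
      rcases lt_or_ge (a.1 u) 0 with h | h
      · have := hmin a (Finset.mem_filter.2 ⟨ha, h⟩)
        rw [le_div_iff₀ (by linarith)] at this
        linarith
      · nlinarith [hx a ha, mul_nonneg hs0 h]
    have hlt : (A.filter fun a => a.1 (x + s • u) ≠ a.2).card < n := by
      rw [← hn]
      refine Finset.card_lt_card ⟨fun a ha => ?_, fun hsub => ?_⟩
      · obtain ⟨haA, hane⟩ := Finset.mem_filter.1 ha
        refine Finset.mem_filter.2 ⟨haA, fun h => hane ?_⟩
        simp [h, hu a haA h]
      · exact (Finset.mem_filter.1 (hsub (Finset.mem_filter.2 ⟨hdA, hdx⟩))).2 hds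
    obtain ⟨y, hyA, hyμ, hyb⟩ := ih _ hlt hy rfl
    refine ⟨y, hyA, hyμ.trans ?_, hyb⟩
    simp only [map_add, map_smul, smul_eq_mul]
    nlinarith [mul_nonneg hs0 (neg_nonneg.2 hμu)]

/-- The sum of the active constraints at a basic point is minimised there only. -/
theorem mem_vertexSet_of_basic (A : Finset (StrongDual ℝ E × ℝ)) {y : E}
    (hy : ∀ a ∈ A, a.2 ≤ a.1 y) (hb : ∀ u, (∀ a ∈ A, a.1 y = a.2 → a.1 u = 0) → u = 0) :
    y ∈ vertexSet {x | ∀ a ∈ A, a.2 ≤ a.1 x} := by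
  classical
  refine ⟨hy, ∑ a ∈ A.filter (fun a => a.1 y = a.2), a.1, fun x hx hne => ?_⟩
  obtain ⟨a, ha, hay, hax⟩ : ∃ a ∈ A, a.1 y = a.2 ∧ a.1 (x - y) ≠ 0 := by
    by_contra! hcon
    exact hne (sub_eq_zero.1 (hb _ hcon))
  have hle : ∀ a ∈ A.filter (fun a => a.1 y = a.2), a.1 y ≤ a.1 x := by
    intro a ha
    obtain ⟨haA, hay⟩ := Finset.mem_filter.1 ha
    rw [hay]; exact hx a haA
  rw [sum_apply, sum_apply]
  have hmem : a ∈ A.filter (fun a => a.1 y = a.2) := Finset.mem_filter.2 ⟨ha, hay⟩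
  refine Finset.sum_lt_sum hle ⟨a, hmem, (hle a hmem).lt_of_ne fun h => hax ?_⟩
  rw [map_sub, h, sub_self]

/-- A polyhedron with a vertex contains no line. -/
theorem eq_zero_of_vertexSet_nonempty (A : Finset (StrongDual ℝ E × ℝ))
    (hV : (vertexSet {x | ∀ a ∈ A, a.2 ≤ a.1 x}).Nonempty) {u : E}
    (hu : ∀ a ∈ A, a.1 u = 0) : u = 0 := by
  obtain ⟨p, hp, ℓ, hℓ⟩ := hV
  by_contra hne
  have h1 := hℓ (p + u) (fun a ha => by simpa [hu a ha] using hp a ha) (by simpa using hne)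
  have h2 := hℓ (p - u) (fun a ha => by simpa [hu a ha] using hp a ha) (by simpa using hne)
  rw [map_add] at h1
  rw [map_sub] at h2
  linarith

/-- On a polyhedron with a vertex, exactly the functionals that are nonnegative on the recession
cone attain their minimum at a vertex. -/
theorem IsPolyhedron.mem_normalSupport_iff {P : Set E} (hP : IsPolyhedron P)
    (hV : (vertexSet P).Nonempty) {μ : StrongDual ℝ E} :
    μ ∈ normalSupport P ↔ ∀ u ∈ recessionCone P, 0 ≤ μ u := by
  classical
  constructor
  · intro h u hu
    simp only [normalSupport, Set.mem_iUnion] at h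
    obtain ⟨p, hp, hμ⟩ := h
    have := hμ _ (hu p hp.1 1 zero_le_one)
    simpa using this
  · intro hμ
    obtain ⟨⟨x₀, hx₀⟩, A, hA⟩ := hP
    have hμ' : ∀ u, (∀ a ∈ A, 0 ≤ a.1 u) → 0 ≤ μ u := fun u hu =>
      hμ u ((mem_recessionCone_iff ⟨x₀, hx₀⟩ hA).2 hu)
    subst hA
    have hptd := fun u => eq_zero_of_vertexSet_nonempty A hV (u := u)
    let B : Set E := {y | (∀ a ∈ A, a.2 ≤ a.1 y) ∧
      ∀ u, (∀ a ∈ A, a.1 y = a.2 → a.1 u = 0) → u = 0}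
    -- A basic point is determined by its active constraints.
    have hfin : B.Finite := by
      refine Set.Finite.of_finite_image (f := fun y => A.filter fun a => a.1 y = a.2)
        ((Finset.finite_toSet A.powerset).subset ?_) ?_
      · rintro _ ⟨y, -, rfl⟩
        exact Finset.mem_coe.2 (Finset.mem_powerset.2 (Finset.filter_subset _ _))
      · intro y hy z hz hyz
        refine sub_eq_zero.1 (hy.2 (y - z) fun a ha hay => ?_)
        have : a ∈ A.filter fun a => a.1 z = a.2 := by
          rw [← show (A.filter fun a => a.1 y = a.2) = A.filter fun a => a.1 z = a.2 from hyz]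
          exact Finset.mem_filter.2 ⟨ha, hay⟩
        rw [map_sub, hay, (Finset.mem_filter.1 this).2, sub_self]
    obtain ⟨y₀, hy₀, -, hb₀⟩ := exists_basic_le A hptd hμ' hx₀
    obtain ⟨y, hy, hmin⟩ := Set.exists_min_image B μ hfin ⟨y₀, hy₀, hb₀⟩
    refine normalCone_subset_normalSupport (mem_vertexSet_of_basic A hy.1 hy.2) fun x hx => ?_
    obtain ⟨z, hz, hzx, hzb⟩ := exists_basic_le A hptd hμ' hx
    exact (hmin z ⟨hz, hzb⟩).trans hzx

/-- The recession cone is the dual of the normal support, because every defining half-space is bounded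
by a functional of the normal support. -/
theorem IsPolyhedron.mem_recessionCone_iff_normalSupport {P : Set E} (hP : IsPolyhedron P)
    (hV : (vertexSet P).Nonempty) {u : E} :
    u ∈ recessionCone P ↔ ∀ μ ∈ normalSupport P, 0 ≤ μ u := by
  refine ⟨fun hu μ hμ => (hP.mem_normalSupport_iff hV).1 hμ u hu, fun h => ?_⟩
  obtain ⟨hne, A, hA⟩ := id hP
  rw [mem_recessionCone_iff hne hA]
  intro a ha
  refine h _ ((hP.mem_normalSupport_iff hV).2 fun w hw => ?_)
  exact (mem_recessionCone_iff hne hA).1 hw a ha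

theorem IsPolyhedron.isPolyhedralCone_normalSupport [FiniteDimensional ℝ E] {P : Set E}
    (hP : IsPolyhedron P) (hV : (vertexSet P).Nonempty) : IsPolyhedralCone (normalSupport P) := by
  classical
  obtain ⟨hne, A, hA⟩ := id hP
  convert isPolyhedralCone_dual (A.image Prod.fst) using 1
  ext μ
  rw [hP.mem_normalSupport_iff hV]
  simp only [mem_recessionCone_iff hne hA, Finset.mem_image, Set.mem_ofPred_eq]
  exact forall_congr' fun u => ⟨fun h hu => h fun a ha => hu _ ⟨a, ha, rfl⟩,
    fun h hu => h (by rintro _ ⟨a, ha, rfl⟩; exact hu a ha)⟩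

/-- The normal cone at a point is dual to the cone of directions that satisfy the active
constraints. -/
theorem mem_normalCone_iff_of_active (A : Finset (StrongDual ℝ E × ℝ)) {p : E}
    (hp : ∀ a ∈ A, a.2 ≤ a.1 p) {μ : StrongDual ℝ E} :
    μ ∈ normalCone {x | ∀ a ∈ A, a.2 ≤ a.1 x} p ↔
      ∀ u, (∀ a ∈ A, a.1 p = a.2 → 0 ≤ a.1 u) → 0 ≤ μ u := by
  constructor
  · intro hμ u hu
    obtain ⟨s, hs, hmem⟩ := exists_pos_add_smul_mem A hp hu
    have := hμ _ hmem
    simp only [map_add, map_smul, smul_eq_mul, le_add_iff_nonneg_right] at this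
    exact nonneg_of_mul_nonneg_right this hs
  · intro h x hx
    have := h (x - p) fun a ha hap => by
      rw [map_sub, hap]; exact sub_nonneg.2 (hx a ha)
    simpa using this

theorem IsPolyhedron.isPolyhedralCone_normalCone [FiniteDimensional ℝ E] {P : Set E}
    (hP : IsPolyhedron P) {p : E} (hp : p ∈ P) : IsPolyhedralCone (normalCone P p) := by
  classical
  obtain ⟨-, A, rfl⟩ := hP
  convert isPolyhedralCone_dual ((A.filter fun a => a.1 p = a.2).image Prod.fst) using 1
  ext μ
  rw [mem_normalCone_iff_of_active A hp]
  refine forall_congr' fun u => ⟨fun h hu => h fun a ha hap => hu _ ?_, fun h hu => h ?_⟩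
  · exact Finset.mem_image_of_mem _ (Finset.mem_filter.2 ⟨ha, hap⟩)
  · intro b hb
    obtain ⟨a, ha, rfl⟩ := Finset.mem_image.1 hb
    exact hu a (Finset.mem_filter.1 ha).1 (Finset.mem_filter.1 ha).2

/-- A functional minimised at one point of a polyhedron only lies in the interior of the normal
cone: it is bounded below by a positive constant on the unit sphere of the cone of feasible
directions. -/
theorem IsPolyhedron.mem_interior_normalCone [FiniteDimensional ℝ E] {P : Set E}
    (hP : IsPolyhedron P) {p : E} (hp : p ∈ P) {ℓ : StrongDual ℝ E}
    (hℓ : ∀ x ∈ P, x ≠ p → ℓ p < ℓ x) : ℓ ∈ interior (normalCone P p) := by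
  obtain ⟨-, A, rfl⟩ := hP
  let T : Set E := {u | ∀ a ∈ A, a.1 p = a.2 → 0 ≤ a.1 u}
  have hTpos : ∀ u ∈ T, u ≠ 0 → 0 < ℓ u := by
    intro u hu hne
    obtain ⟨s, hs, hmem⟩ := exists_pos_add_smul_mem A hp hu
    have := hℓ _ hmem (by simp [hs.ne', hne])
    simp only [map_add, map_smul, smul_eq_mul, lt_add_iff_pos_right] at this
    exact pos_of_mul_pos_right this hs.le
  have hTclosed : IsClosed T := by
    have : T = ⋂ a ∈ A, {u : E | a.1 p = a.2 → 0 ≤ a.1 u} := by ext; simp [T]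
    rw [this]
    refine isClosed_biInter fun a _ => ?_
    by_cases h : a.1 p = a.2
    · simpa [h] using isClosed_le continuous_const a.1.continuous
    · simp [h]
  have hK : IsCompact (T ∩ Metric.sphere 0 1) := (isCompact_sphere 0 1).inter_left hTclosed
  obtain ⟨δ, hδ, hbound⟩ : ∃ δ > 0, ∀ u ∈ T ∩ Metric.sphere 0 1, δ ≤ ℓ u := by
    rcases (T ∩ Metric.sphere 0 1).eq_empty_or_nonempty with h | h
    · exact ⟨1, one_pos, by simp [h]⟩
    · obtain ⟨u, hu, hmin⟩ := hK.exists_isMinOn h ℓ.continuous.continuousOn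
      refine ⟨ℓ u, hTpos u hu.1 ?_, fun w hw => hmin hw⟩
      rintro rfl
      simpa using hu.2
  rw [mem_interior_iff_mem_nhds]
  refine Metric.mem_nhds_iff.2 ⟨δ, hδ, fun μ hμ => ?_⟩
  rw [mem_normalCone_iff_of_active A hp]
  intro u hu
  rcases eq_or_ne u 0 with rfl | hne
  · simp
  have hnorm : 0 < ‖u‖ := norm_pos_iff.2 hne
  have h1 : δ ≤ ℓ (‖u‖⁻¹ • u) := hbound _ ⟨fun a ha hap => by
    simpa using mul_nonneg (inv_nonneg.2 hnorm.le) (hu a ha hap), by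
      simp [norm_smul, hnorm.ne']⟩
  have h2 : |(μ - ℓ) (‖u‖⁻¹ • u)| ≤ ‖μ - ℓ‖ * 1 := by
    have := (μ - ℓ).le_opNorm (‖u‖⁻¹ • u)
    rwa [norm_smul, norm_inv, norm_norm, inv_mul_cancel₀ hnorm.ne'] at this
  rw [mem_ball_iff_norm] at hμ
  have h3 : 0 < μ (‖u‖⁻¹ • u) := by
    rw [sub_apply] at h2
    linarith [neg_abs_le (μ (‖u‖⁻¹ • u) - ℓ (‖u‖⁻¹ • u))]
  rw [map_smul, smul_eq_mul] at h3
  exact (pos_of_mul_pos_right h3 (inv_nonneg.2 hnorm.le)).le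

theorem IsPolyhedron.interior_normalCone_nonempty [FiniteDimensional ℝ E] {P : Set E}
    (hP : IsPolyhedron P) {p : E} (hp : p ∈ vertexSet P) :
    (interior (normalCone P p)).Nonempty := by
  obtain ⟨hpP, ℓ, hℓ⟩ := hp
  exact ⟨ℓ, hP.mem_interior_normalCone hpP hℓ⟩

/-- A polyhedron with prescribed vertices and normal support: if a polyhedral cone `K` is
subdivided into full-dimensional cones by the points of `V` that are least on them, there is a
polyhedron with vertex set `V` and these normal cones. It is the intersection of the half-spaces
`μ γ ≤ μ x` for `μ` in the part of `K` that belongs to `γ`. -/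
theorem exists_isPolyhedron_normalCone_eq [FiniteDimensional ℝ E] {K : Set (StrongDual ℝ E)}
    (hK : IsPolyhedralCone K) {V : Set E} (hVfin : V.Finite) (hVne : V.Nonempty)
    (hfull : ∀ γ ∈ V, (interior {μ ∈ K | ∀ γ' ∈ V, μ γ ≤ μ γ'}).Nonempty) :
    ∃ P : Set E, IsPolyhedron P ∧ vertexSet P = V ∧
      ∀ γ ∈ V, normalCone P γ = {μ ∈ K | ∀ γ' ∈ V, μ γ ≤ μ γ'} := by
  classical
  let N : E → Set (StrongDual ℝ E) := fun γ => {μ ∈ K | ∀ γ' ∈ V, μ γ ≤ μ γ'}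
  have hgen : ∀ γ : E, ∃ G : Finset (StrongDual ℝ E), (∀ g ∈ G, g ∈ N γ) ∧
      ∀ x : E, (∀ g ∈ G, 0 ≤ g x) → ∀ μ ∈ N γ, 0 ≤ μ x := by
    intro γ
    obtain ⟨T, hT⟩ := isPolyhedralCone_setOf_le hK hVfin γ
    let ev : E → (StrongDual ℝ E →ₗ[ℝ] ℝ) := fun x => (ContinuousLinearMap.apply ℝ ℝ x).toLinearMap
    obtain ⟨G, hG, hdual⟩ := exists_finset_test_vectors (T.image ev)
    refine ⟨G, fun g hg => ?_, fun x hx μ hμ => ?_⟩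
    · simp only [N, hT]
      exact fun x hx => hG g hg (ev x) (Finset.mem_image_of_mem _ hx)
    · refine hdual (ev x) hx μ fun f hf => ?_
      obtain ⟨y, hy, rfl⟩ := Finset.mem_image.1 hf
      simp only [N, hT] at hμ
      exact hμ y hy
  choose G hG using hgen
  let P : Set E := {x | ∀ γ ∈ V, ∀ μ ∈ N γ, μ γ ≤ μ x}
  have hVP : V ⊆ P := fun γ hγ γ' hγ' μ hμ => hμ.2 γ hγ
  have hPoly : IsPolyhedron P := by
    refine ⟨hVne.mono hVP, hVfin.toFinset.biUnion fun γ => (G γ).image fun g => (g, g γ), ?_⟩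
    ext x
    simp only [P, Set.mem_ofPred_eq, Finset.mem_biUnion, Set.Finite.mem_toFinset,
      Finset.mem_image]
    constructor
    · rintro h _ ⟨γ, hγ, g, hg, rfl⟩
      exact h γ hγ g ((hG γ).1 g hg)
    · intro h γ hγ μ hμ
      have := (hG γ).2 (x - γ) (fun g hg => by
        have := h _ ⟨γ, hγ, g, hg, rfl⟩
        simpa using this) μ hμ
      simpa using this
  -- `P` recedes in all directions on which `K` is nonnegative, so minimised functionals lie in `K`.
  have hminK : ∀ w ∈ P, ∀ μ ∈ normalCone P w, μ ∈ K := by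
    intro w hw μ hμ
    obtain ⟨T, hT⟩ := id hK
    rw [hT]
    intro x hx
    have hwx : w + x ∈ P := by
      intro γ hγ ν hν
      have hνK : ν ∈ K := hν.1
      rw [hT] at hνK
      have := hw γ hγ ν hν
      rw [map_add]
      linarith [hνK x hx]
    have := hμ _ hwx
    simpa using this
  have hNormal : ∀ γ ∈ V, normalCone P γ = N γ := fun γ hγ =>
    Set.Subset.antisymm
      (fun μ hμ => ⟨hminK γ (hVP hγ) μ hμ, fun γ' hγ' => hμ γ' (hVP hγ')⟩)
      (fun μ hμ x hx => hx γ hγ μ hμ)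
  refine ⟨P, hPoly, Set.Subset.antisymm ?_ ?_, hNormal⟩
  · rintro w ⟨hwP, ℓ, hℓ⟩
    have hℓK : ℓ ∈ K := hminK w hwP ℓ fun x hx => by
      rcases eq_or_ne x w with rfl | h
      exacts [le_rfl, (hℓ x hx h).le]
    obtain ⟨γ, hγ, hmin⟩ := Set.exists_min_image V ℓ hVfin hVne
    by_contra hne
    have h1 := hℓ γ (hVP hγ) (fun h => hne (h ▸ hγ))
    exact absurd (hwP γ hγ ℓ ⟨hℓK, hmin⟩) h1.not_ge
  · intro γ hγ
    obtain ⟨ℓ, hℓ⟩ := hfull γ hγ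
    have hℓ : ℓ ∈ interior (normalCone P γ) := by rw [hNormal γ hγ]; exact hℓ
    exact ⟨hVP hγ, ℓ, fun x hx hne => apply_lt_of_mem_interior_normalCone hℓ hx hne⟩

/-! ### Functionals in general position -/

theorem dense_setOf_forall_apply_ne_zero {U : Set E} (hU : U.Finite) (h0 : ∀ u ∈ U, u ≠ 0) :
    Dense {μ : StrongDual ℝ E | ∀ u ∈ U, μ u ≠ 0} := by
  have hopen : ∀ u : E, IsOpen {μ : StrongDual ℝ E | μ u ≠ 0} := fun u =>
    isOpen_ne_fun (ContinuousLinearMap.apply ℝ ℝ u).continuous continuous_const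
  have hdense : ∀ u : E, u ≠ 0 → Dense {μ : StrongDual ℝ E | μ u ≠ 0} := by
    intro u hu
    obtain ⟨f, -, hf⟩ := exists_dual_vector ℝ u (norm_ne_zero_iff.2 hu)
    have hfu : f u ≠ 0 := by rw [hf]; simpa using hu
    intro μ
    rw [mem_closure_iff_frequently]
    have hc : Filter.Tendsto (fun s : ℝ => μ + s • f) (nhdsWithin 0 {0}ᶜ) (nhds μ) := by
      have : Continuous fun s : ℝ => μ + s • f := by fun_prop
      have := this.tendsto 0
      simp only [zero_smul, add_zero] at this
      exact this.mono_left nhdsWithin_le_nhds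
    refine hc.frequently (Filter.Eventually.frequently ?_)
    have hev : ∀ᶠ s : ℝ in nhdsWithin 0 {0}ᶜ, s ≠ -(μ u) / f u := by
      rcases eq_or_ne (-(μ u) / f u) 0 with h | h
      · rw [h]; exact self_mem_nhdsWithin
      · exact nhdsWithin_le_nhds (isOpen_ne.mem_nhds h.symm)
    filter_upwards [hev] with s hs h
    apply hs
    rw [eq_div_iff hfu]
    simp only [add_apply, smul_apply, smul_eq_mul] at h
    linarith
  have : {μ : StrongDual ℝ E | ∀ u ∈ U, μ u ≠ 0} = ⋂ u ∈ U, {μ : StrongDual ℝ E | μ u ≠ 0} := by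
    ext; simp
  rw [this]
  exact dense_biInter_of_isOpen (fun u _ => hopen u) hU.countable fun u hu => hdense u (h0 u hu)

/-- A nonempty open set contains a functional off finitely many hyperplanes. -/
theorem exists_mem_forall_apply_ne_zero {U : Set E} (hU : U.Finite) {O : Set (StrongDual ℝ E)}
    (hO : IsOpen O) (hne : O.Nonempty) : ∃ μ ∈ O, ∀ u ∈ U, u ≠ 0 → μ u ≠ 0 := by
  obtain ⟨μ, hμO, hμ⟩ := (dense_setOf_forall_apply_ne_zero (hU.subset (Set.sep_subset U (· ≠ 0)))
    (fun u hu => hu.2)).inter_open_nonempty O hO hne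
  exact ⟨μ, hμO, fun u hu h0 => hμ u ⟨hu, h0⟩⟩

/-- Near any point of a full-dimensional convex set there are interior points off finitely many
hyperplanes. -/
theorem exists_mem_interior_forall_apply_ne_zero {D : Set (StrongDual ℝ E)} (hD : Convex ℝ D)
    (hfull : (interior D).Nonempty) {x : StrongDual ℝ E} (hx : x ∈ D)
    {O : Set (StrongDual ℝ E)} (hO : IsOpen O) (hxO : x ∈ O) {U : Set E} (hU : U.Finite) :
    ∃ b ∈ interior D, b ∈ O ∧ ∀ u ∈ U, u ≠ 0 → b u ≠ 0 := by
  have hx' : x ∈ closure (interior D) := by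
    rw [hD.closure_interior_eq_closure_of_nonempty_interior hfull]
    exact subset_closure hx
  obtain ⟨b, ⟨hbO, hb⟩, hbU⟩ := exists_mem_forall_apply_ne_zero hU (hO.inter isOpen_interior)
    (mem_closure_iff.1 hx' O hO hxO)
  exact ⟨b, hb, hbO, hbU⟩

namespace PolyhedralPolynomial

variable (φ : PolyhedralPolynomial E)

/-! ### The points `ρ^{(v)}_{i,j}` and the normal cone of `M` at `v` -/

/-- The set of all points `ρ^{(v)}_{i,j}` with `i ≠ j` in the support. -/
def rhoSet (v : E) : Set E :=
  {γ | ∃ i ∈ φ.supp, ∃ j ∈ φ.supp, i ≠ j ∧ φ.rho v i j = γ}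

theorem finite_rhoSet (v : E) : (φ.rhoSet v).Finite := by
  refine ((φ.supp ×ˢ φ.supp).finite_toSet.image fun p => φ.rho v p.1 p.2).subset ?_
  rintro _ ⟨i, hi, j, hj, -, rfl⟩
  exact ⟨(i, j), by simp [hi, hj], rfl⟩

/-- The points of the indices `i` and `j` coincide at `ρ_{i,j}`, so the primary inequalities do not
depend on the order of the pair. -/
theorem shifted_left_eq_right (v : E) {i j : ℕ} (hij : i ≠ j) :
    φ.shifted v i j i = φ.shifted v i j j := by
  have h : (i : ℝ) - j ≠ 0 := sub_ne_zero.2 (by exact_mod_cast hij)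
  have h2 : ((i : ℝ) - j) • φ.rho v i j = -(φ.component v i - φ.component v j) := by
    rw [rho, smul_neg, smul_smul, mul_inv_cancel₀ h, one_smul]
  rw [sub_smul] at h2
  rw [shifted, shifted, ← sub_eq_zero]
  calc _ = ((i : ℝ) • φ.rho v i j - (j : ℝ) • φ.rho v i j) +
        (φ.component v i - φ.component v j) := by abel
    _ = 0 := by rw [h2]; abel

theorem shifted_congr {v : E} {i j i' j' : ℕ} (h : φ.rho v i j = φ.rho v i' j') (k : ℕ) :
    φ.shifted v i j k = φ.shifted v i' j' k := by
  rw [shifted, shifted, h]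

/-- Conversely to `shifted_left_eq_right`, a point at which two summands meet is `ρ_{l,m}`. -/
theorem eq_rho_of_add_smul_eq {v γ : E} {l m : ℕ} (hlm : l ≠ m)
    (h : φ.component v l + (l : ℝ) • γ = φ.component v m + (m : ℝ) • γ) :
    φ.rho v l m = γ := by
  have hne : (l : ℝ) - m ≠ 0 := sub_ne_zero.2 (by exact_mod_cast hlm)
  have h2 : ((l : ℝ) - m) • γ = -(φ.component v l - φ.component v m) := by
    rw [sub_smul, ← sub_eq_zero]
    rw [← sub_eq_zero] at h
    rw [← h]; abel
  rw [rho, ← smul_neg, ← h2, smul_smul, inv_mul_cancel₀ hne, one_smul]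

variable {φ} in
/-- For a generic polynomial the primary inequalities of a pair depend only on its point `ρ`. -/
theorem IsGeneric.primary_congr (hφ : φ.IsGeneric) {v : E} (hv : v ∈ vertexSet φ.coeffSum)
    {i j i' j' : ℕ} (hi : i ∈ φ.supp) (hj : j ∈ φ.supp) (hi' : i' ∈ φ.supp) (hj' : j' ∈ φ.supp)
    (hij : i ≠ j) (hij' : i' ≠ j') (h : φ.rho v i j = φ.rho v i' j') :
    φ.shifted v i j i = φ.shifted v i' j' i' := by
  have hset := hφ v hv i hi j hj i' hi' j' hj' hij hij' h
  have hmem : i' ∈ ({i, j} : Set ℕ) := by rw [hset]; exact Set.mem_insert _ _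
  rw [← φ.shifted_congr h]
  rcases hmem with rfl | hmem
  · rfl
  · rw [Set.mem_singleton_iff.1 hmem]
    exact φ.shifted_left_eq_right v hij

/-- The normal cone of a Minkowski sum is the intersection of the normal cones of the components. -/
theorem normalCone_coeffSum {v : E} (hv : v ∈ vertexSet φ.coeffSum) :
    normalCone φ.coeffSum v = ⋂ i ∈ φ.supp, normalCone (φ.coeff i) (φ.component v i) := by
  classical
  obtain ⟨hc, hs⟩ := φ.isDecomposition_component hv
  ext μ
  simp only [Set.mem_iInter]
  constructor
  · intro hμ i hi x hx
    have hmem : ∑ k ∈ φ.supp, Function.update (φ.component v) i x k ∈ φ.coeffSum := by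
      refine Set.mem_finsetSum (t := φ.supp) (f := φ.coeff) _ |>.2
        ⟨Function.update (φ.component v) i x, fun {k} hk => ?_, rfl⟩
      by_cases h : k = i
      · subst h; simpa using hx
      · simpa [h] using (hc k hk).1
    have h := hμ _ hmem
    have hsum : ∑ k ∈ φ.supp, Function.update (φ.component v) i x k =
        (∑ k ∈ φ.supp, φ.component v k) - φ.component v i + x := by
      rw [Finset.sum_update_of_mem hi, ← Finset.add_sum_erase _ _ hi,
        Finset.sdiff_singleton_eq_erase]
      abel
    rw [hsum, hs] at h
    simp only [map_add, map_sub] at h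
    linarith
  · intro hμ x hx
    obtain ⟨d, hd, rfl⟩ := (Set.mem_finsetSum (t := φ.supp) (f := φ.coeff) x).1 hx
    rw [← hs, map_sum, map_sum]
    exact Finset.sum_le_sum fun i hi => hμ i hi (d i) (hd hi)

theorem isPolyhedralCone_normalCone_coeffSum [FiniteDimensional ℝ E] {v : E}
    (hv : v ∈ vertexSet φ.coeffSum) :
    IsPolyhedralCone (normalCone φ.coeffSum v) := by
  rw [φ.normalCone_coeffSum hv]
  exact isPolyhedralCone_biInter _ _ fun i hi =>
    (φ.isPolyhedron_coeff i hi).isPolyhedralCone_normalCone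
      ((φ.isDecomposition_component hv).1 i hi).1

/-! ### Chambers of the arrangement -/

theorem finite_arrangementNormals (v : E) : (φ.arrangementNormals v).Finite := by
  have h1 : (⋃ p ∈ φ.supp ×ˢ φ.supp ×ˢ φ.supp,
      {φ.shifted v p.1 p.2.1 p.2.2 - φ.shifted v p.1 p.2.1 p.1}).Finite :=
    (Finset.finite_toSet _).biUnion fun _ _ => Set.finite_singleton _
  have h2 : (⋃ p ∈ φ.supp ×ˢ φ.supp ×ˢ φ.supp ×ˢ φ.supp,
      {φ.rho v p.1 p.2.1 - φ.rho v p.2.2.1 p.2.2.2}).Finite :=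
    (Finset.finite_toSet _).biUnion fun _ _ => Set.finite_singleton _
  refine (h1.union h2).subset ?_
  rintro u ⟨-, ⟨i, hi, j, hj, k, hk, -, rfl⟩ | ⟨i, hi, j, hj, i', hi', j', hj', -, -, rfl⟩⟩
  · exact .inl (Set.mem_biUnion (x := (i, j, k)) (by simp [hi, hj, hk]) rfl)
  · exact .inr (Set.mem_biUnion (x := (i, j, i', j')) (by simp [hi, hj, hi', hj']) rfl)

/-- The part of `N_M(v)` weakly on the same side as `e` of every hyperplane of the arrangement.
It is a maximal cone of the fan when `e` is regular. -/
def chamber (v : E) (e : StrongDual ℝ E) : Set (StrongDual ℝ E) :=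
  {μ ∈ normalCone φ.coeffSum v | ∀ u ∈ φ.arrangementNormals v, 0 ≤ e u * μ u}

/-- A functional is regular if it is interior to `N_M(v)` and off all hyperplanes of the
arrangement. -/
def IsRegular (v : E) (e : StrongDual ℝ E) : Prop :=
  e ∈ interior (normalCone φ.coeffSum v) ∧ ∀ u ∈ φ.arrangementNormals v, e u ≠ 0

variable {φ} {v : E} {e e' : StrongDual ℝ E}

theorem mem_maximalCones_iff {C : Set (StrongDual ℝ E)} :
    C ∈ φ.maximalCones v ↔ ∃ e, φ.IsRegular v e ∧ C = φ.chamber v e :=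
  ⟨fun ⟨e, h1, h2, h3⟩ => ⟨e, ⟨h1, h2⟩, h3⟩, fun ⟨e, ⟨h1, h2⟩, h3⟩ => ⟨e, h1, h2, h3⟩⟩

theorem IsRegular.mem_chamber (he : φ.IsRegular v e) : e ∈ φ.chamber v e :=
  ⟨interior_subset he.1, fun _ _ => mul_self_nonneg _⟩

theorem chamber_congr (h : ∀ u ∈ φ.arrangementNormals v, 0 < e u * e' u) :
    φ.chamber v e = φ.chamber v e' := by
  have key : ∀ {x y z : ℝ}, 0 < x * y → 0 ≤ x * z → 0 ≤ y * z := by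
    intro x y z hxy hxz
    rcases pos_and_pos_or_neg_and_neg_of_mul_pos hxy with ⟨hx, hy⟩ | ⟨hx, hy⟩
    · exact mul_nonneg hy.le (nonneg_of_mul_nonneg_right hxz hx)
    · exact mul_nonneg_of_nonpos_of_nonpos hy.le
        (by by_contra! hz; exact absurd hxz (mul_neg_of_neg_of_pos hx hz).not_ge)
  ext μ
  exact and_congr_right fun _ => forall₂_congr fun u hu =>
    ⟨key (h u hu), key (by rw [mul_comm]; exact h u hu)⟩

theorem IsRegular.chamber_eq_of_mem (he : φ.IsRegular v e) (he' : φ.IsRegular v e')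
    (h : e' ∈ φ.chamber v e) : φ.chamber v e' = φ.chamber v e :=
  (chamber_congr fun u hu =>
    (h.2 u hu).lt_of_ne (mul_ne_zero (he.2 u hu) (he'.2 u hu)).symm).symm

theorem IsRegular.mem_interior_chamber (he : φ.IsRegular v e) :
    e ∈ interior (φ.chamber v e) := by
  rw [mem_interior_iff_mem_nhds]
  have h1 : ∀ᶠ μ in nhds e, μ ∈ normalCone φ.coeffSum v := mem_interior_iff_mem_nhds.1 he.1
  have h2 : ∀ᶠ μ in nhds e, ∀ u ∈ φ.arrangementNormals v, 0 ≤ e u * μ u := by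
    rw [(φ.finite_arrangementNormals v).eventually_all]
    intro u hu
    have hc : Continuous fun μ : StrongDual ℝ E => e u * μ u :=
      continuous_const.mul (ContinuousLinearMap.apply ℝ ℝ u).continuous
    exact ((hc.tendsto e).eventually (lt_mem_nhds (mul_self_pos.2 (he.2 u hu)))).mono
      fun _ h => h.le
  exact h1.and h2

theorem isClosed_chamber : IsClosed (φ.chamber v e) := by
  have : φ.chamber v e = normalCone φ.coeffSum v ∩
      ⋂ u ∈ φ.arrangementNormals v, {μ : StrongDual ℝ E | 0 ≤ e u * μ u} := by
    ext; simp [chamber]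
  rw [this]
  refine (isClosed_normalCone _ _).inter (isClosed_biInter fun u _ => ?_)
  exact isClosed_le continuous_const
    (continuous_const.mul (ContinuousLinearMap.apply ℝ ℝ u).continuous)

theorem isClosed_of_mem_maximalCones {C : Set (StrongDual ℝ E)} (hC : C ∈ φ.maximalCones v) :
    IsClosed C := by
  obtain ⟨e, -, rfl⟩ := mem_maximalCones_iff.1 hC
  exact isClosed_chamber

/-- A maximal cone is determined by the set of normals positive at a regular point of it. -/
theorem finite_maximalCones (φ : PolyhedralPolynomial E) (v : E) : (φ.maximalCones v).Finite := by
  refine ((φ.finite_arrangementNormals v).finite_subsets.image fun A =>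
    {μ ∈ normalCone φ.coeffSum v | ∀ u ∈ φ.arrangementNormals v,
      (u ∈ A → 0 ≤ μ u) ∧ (u ∉ A → μ u ≤ 0)}).subset ?_
  intro C hC
  obtain ⟨e, he, rfl⟩ := mem_maximalCones_iff.1 hC
  refine ⟨{u ∈ φ.arrangementNormals v | 0 < e u}, Set.sep_subset _ _, ?_⟩
  ext μ
  refine and_congr_right fun _ => forall₂_congr fun u hu => ?_
  rcases (he.2 u hu).lt_or_gt with h | h
  · have : 0 ≤ e u * μ u ↔ μ u ≤ 0 := by
      rw [← neg_mul_neg, mul_nonneg_iff_of_pos_left (neg_pos.2 h), neg_nonneg]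
    simp [h.not_gt, this]
  · simp [h, hu, mul_nonneg_iff_of_pos_left h]

/-! ### The cells of a vertex set -/

variable (φ v) in
/-- Normal vectors of the inequalities, apart from those of `N_M(v)`, that a functional satisfies
if `γ` is the least point of `V` and all primary inequalities of pairs with point `γ` hold. -/
def cellNormals (V : Set E) (γ : E) : Set E :=
  {u | (∃ γ' ∈ V, u = γ' - γ) ∨
    ∃ i ∈ φ.supp, ∃ j ∈ φ.supp, ∃ k ∈ φ.supp, i ≠ j ∧ φ.rho v i j = γ ∧
      u = φ.shifted v i j k - φ.shifted v i j i}

variable (φ v) in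
/-- The largest cone that `γ` can have as its normal cone in a `v`-local solution with vertex set
`V`. -/
def cell (V : Set E) (γ : E) : Set (StrongDual ℝ E) :=
  {μ ∈ normalCone φ.coeffSum v | ∀ u ∈ φ.cellNormals v V γ, 0 ≤ μ u}

theorem mem_cell_iff {V : Set E} {γ : E} {μ : StrongDual ℝ E} :
    μ ∈ φ.cell v V γ ↔ μ ∈ normalCone φ.coeffSum v ∧ (∀ γ' ∈ V, μ γ ≤ μ γ') ∧
      ∀ i ∈ φ.supp, ∀ j ∈ φ.supp, i ≠ j → φ.rho v i j = γ →
        ∀ k ∈ φ.supp, μ (φ.shifted v i j i) ≤ μ (φ.shifted v i j k) := by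
  refine and_congr_right fun _ => ⟨fun h => ⟨fun γ' hγ' => ?_, fun i hi j hj hij hρ k hk => ?_⟩,
    ?_⟩
  · simpa using h _ (.inl ⟨γ', hγ', rfl⟩)
  · simpa using h _ (.inr ⟨i, hi, j, hj, k, hk, hij, hρ, rfl⟩)
  · rintro ⟨h1, h2⟩ u (⟨γ', hγ', rfl⟩ | ⟨i, hi, j, hj, k, hk, hij, hρ, rfl⟩)
    · simpa using h1 γ' hγ'
    · simpa using h2 i hi j hj hij hρ k hk

theorem mem_arrangementNormals_of_mem_cellNormals {V : Set E} (hV : V ⊆ φ.rhoSet v) {γ : E}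
    (hγ : γ ∈ V) {u : E} (hu : u ∈ φ.cellNormals v V γ) (h0 : u ≠ 0) :
    u ∈ φ.arrangementNormals v := by
  refine ⟨h0, ?_⟩
  rcases hu with ⟨γ', hγ', rfl⟩ | ⟨i, hi, j, hj, k, hk, hij, -, rfl⟩
  · obtain ⟨i, hi, j, hj, hij, rfl⟩ := hV hγ
    obtain ⟨i', hi', j', hj', hij', rfl⟩ := hV hγ'
    exact .inr ⟨i', hi', j', hj', i, hi, j, hj, hij', hij, rfl⟩
  · exact .inl ⟨i, hi, j, hj, k, hk, hij, rfl⟩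

theorem sub_mem_arrangementNormals {γ γ' : E} (hγ : γ ∈ φ.rhoSet v) (hγ' : γ' ∈ φ.rhoSet v)
    (hne : γ ≠ γ') : γ - γ' ∈ φ.arrangementNormals v := by
  obtain ⟨i, hi, j, hj, hij, rfl⟩ := hγ
  obtain ⟨i', hi', j', hj', hij', rfl⟩ := hγ'
  exact ⟨sub_ne_zero.2 hne, .inr ⟨i, hi, j, hj, i', hi', j', hj', hij, hij', rfl⟩⟩

theorem isPolyhedralCone_cell [FiniteDimensional ℝ E] (hv : v ∈ vertexSet φ.coeffSum) {V : Set E}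
    (hV : V ⊆ φ.rhoSet v) {γ : E} (hγ : γ ∈ V) : IsPolyhedralCone (φ.cell v V γ) := by
  have hfin : (φ.cellNormals v V γ).Finite := by
    refine ((φ.finite_arrangementNormals v).insert 0).subset fun u hu => ?_
    by_cases h0 : u = 0
    exacts [.inl h0, .inr (mem_arrangementNormals_of_mem_cellNormals hV hγ hu h0)]
  exact (φ.isPolyhedralCone_normalCone_coeffSum hv).inter (isPolyhedralCone_of_finite hfin)

theorem IsRegular.chamber_subset_cell (he : φ.IsRegular v e) {V : Set E} (hV : V ⊆ φ.rhoSet v)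
    {γ : E} (hγ : γ ∈ V) (h : e ∈ φ.cell v V γ) : φ.chamber v e ⊆ φ.cell v V γ := by
  refine fun μ hμ => ⟨hμ.1, fun u hu => ?_⟩
  rcases eq_or_ne u 0 with rfl | h0
  · simp
  have hA := mem_arrangementNormals_of_mem_cellNormals hV hγ hu h0
  exact nonneg_of_mul_nonneg_right (hμ.2 u hA) ((h.2 u hu).lt_of_ne (he.2 u hA).symm)

/-- Cells of different points have no regular functional in common. -/
theorem IsRegular.eq_of_mem_cell (he : φ.IsRegular v e) {V : Set E} (hV : V ⊆ φ.rhoSet v)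
    {γ γ' : E} (hγ : γ ∈ V) (hγ' : γ' ∈ V) (h : e ∈ φ.cell v V γ) (h' : e ∈ φ.cell v V γ') :
    γ = γ' := by
  by_contra hne
  refine he.2 _ (sub_mem_arrangementNormals (hV hγ) (hV hγ') hne) ?_
  rw [map_sub, sub_eq_zero]
  exact le_antisymm ((mem_cell_iff.1 h).2.1 γ' hγ') ((mem_cell_iff.1 h').2.1 γ hγ)

/-- Near any point of a full-dimensional cell there are points interior to the cell that avoid
finitely many hyperplanes. -/
theorem exists_mem_interior_cell [FiniteDimensional ℝ E] (hv : v ∈ vertexSet φ.coeffSum)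
    {V : Set E} (hV : V ⊆ φ.rhoSet v) {γ : E} (hγ : γ ∈ V)
    (hfull : (interior (φ.cell v V γ)).Nonempty) {x : StrongDual ℝ E} (hx : x ∈ φ.cell v V γ)
    {O : Set (StrongDual ℝ E)} (hO : IsOpen O) (hxO : x ∈ O) {U : Set E} (hU : U.Finite) :
    ∃ b ∈ interior (φ.cell v V γ), b ∈ O ∧ φ.IsRegular v b ∧ ∀ u ∈ U, u ≠ 0 → b u ≠ 0 := by
  obtain ⟨b, hb, hbO, hbU⟩ := exists_mem_interior_forall_apply_ne_zero
    (isPolyhedralCone_cell hv hV hγ).convex hfull hx hO hxO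
    ((φ.finite_arrangementNormals v).union hU)
  exact ⟨b, hb, hbO, ⟨interior_mono (fun μ hμ => hμ.1) hb,
    fun u hu => hbU u (.inl hu) hu.1⟩, fun u hu => hbU u (.inr hu)⟩

/-- A full-dimensional cell is the union of the maximal cones in it. -/
theorem cell_subset_biUnion [FiniteDimensional ℝ E] (hv : v ∈ vertexSet φ.coeffSum)
    {V : Set E} (hV : V ⊆ φ.rhoSet v) {γ : E} (hγ : γ ∈ V)
    (hfull : (interior (φ.cell v V γ)).Nonempty) :
    φ.cell v V γ ⊆ ⋃ C ∈ {C ∈ φ.maximalCones v | C ⊆ φ.cell v V γ}, C := by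
  intro x hx
  have hclosed : IsClosed (⋃ C ∈ {C ∈ φ.maximalCones v | C ⊆ φ.cell v V γ}, C) :=
    ((finite_maximalCones φ v).subset (Set.sep_subset _ _)).isClosed_biUnion
      fun C hC => isClosed_of_mem_maximalCones hC.1
  by_contra hcon
  obtain ⟨b, hb, hbO, hreg, -⟩ := exists_mem_interior_cell hv hV hγ hfull hx hclosed.isOpen_compl
    hcon Set.finite_empty
  exact hbO (Set.mem_biUnion (x := φ.chamber v b) ⟨mem_maximalCones_iff.2 ⟨b, hreg, rfl⟩,
    hreg.chamber_subset_cell hV hγ (interior_subset hb)⟩ hreg.mem_chamber)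

theorem mem_coneAt_iff {t : ℕ} {C : Fin t → Set (StrongDual ℝ E)} {i j : Fin t → ℕ} {γ : E}
    {μ : StrongDual ℝ E} :
    μ ∈ φ.coneAt v C i j γ ↔ ∃ k, φ.rho v (i k) (j k) = γ ∧ μ ∈ C k := by
  simp [coneAt]

/-- All maximal cones contained in the cells of `V` form a compatible system. -/
theorem exists_isLocalCompatibleSystem [FiniteDimensional ℝ E] (hφ : φ.IsGeneric)
    (hv : v ∈ vertexSet φ.coeffSum)
    {V : Set E} (hV : V ⊆ φ.rhoSet v) (hVne : V.Nonempty)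
    (hfull : ∀ γ ∈ V, (interior (φ.cell v V γ)).Nonempty) :
    ∃ (t : ℕ) (C : Fin t → Set (StrongDual ℝ E)) (i j : Fin t → ℕ),
      φ.IsLocalCompatibleSystem v C i j ∧ V = Set.range (fun k => φ.rho v (i k) (j k)) ∧
        ∀ γ ∈ V, φ.coneAt v C i j γ = φ.cell v V γ := by
  classical
  let S : Set (Set (StrongDual ℝ E)) := {C ∈ φ.maximalCones v | ∃ γ ∈ V, C ⊆ φ.cell v V γ}
  have hfin : S.Finite := (finite_maximalCones φ v).subset (Set.sep_subset _ _)
  have : Fintype S := hfin.fintype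
  let σ : Fin (Fintype.card S) ≃ S := (Fintype.equivFin S).symm
  have hchoice : ∀ C : S, ∃ i ∈ φ.supp, ∃ j ∈ φ.supp, i ≠ j ∧ φ.rho v i j ∈ V ∧
      C.1 ⊆ φ.cell v V (φ.rho v i j) := by
    rintro ⟨C, hC, γ, hγ, hCγ⟩
    obtain ⟨i, hi, j, hj, hij, rfl⟩ := hV hγ
    exact ⟨i, hi, j, hj, hij, hγ, hCγ⟩
  choose i hi j hj hij hρV hsub using hchoice
  have huniq : ∀ (C : S) (γ : E), γ ∈ V → C.1 ⊆ φ.cell v V γ → φ.rho v (i C) (j C) = γ := by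
    intro C γ hγ hCγ
    obtain ⟨e, he, hCe⟩ := mem_maximalCones_iff.1 C.2.1
    have heC : e ∈ C.1 := by rw [hCe]; exact he.mem_chamber
    exact he.eq_of_mem_cell hV (hρV C) hγ (hsub C heC) (hCγ heC)
  have hcone : ∀ γ ∈ V, φ.coneAt v (fun k => (σ k).1) (fun k => i (σ k)) (fun k => j (σ k)) γ =
      φ.cell v V γ := by
    intro γ hγ
    ext μ
    rw [mem_coneAt_iff]
    constructor
    · rintro ⟨k, rfl, hμ⟩
      exact hsub _ hμ
    · intro hμ
      obtain ⟨C, hC, hμC⟩ := Set.mem_iUnion₂.1 (cell_subset_biUnion hv hV hγ (hfull γ hγ) hμ)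
      let C' : S := ⟨C, hC.1, γ, hγ, hC.2⟩
      refine ⟨σ.symm C', ?_, ?_⟩
      · rw [Equiv.apply_symm_apply]
        exact huniq C' γ hγ hC.2
      · rw [Equiv.apply_symm_apply]
        exact hμC
  have hrange : V = Set.range fun k => φ.rho v (i (σ k)) (j (σ k)) := by
    refine Set.Subset.antisymm (fun γ hγ => ?_) ?_
    · obtain ⟨e, he⟩ := hfull γ hγ
      have he := interior_subset he
      rw [← hcone γ hγ, mem_coneAt_iff] at he
      obtain ⟨k, hk, -⟩ := he
      exact ⟨k, hk⟩
    · rintro _ ⟨k, rfl⟩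
      exact hρV _
  refine ⟨_, fun k => (σ k).1, fun k => i (σ k), fun k => j (σ k), ?_, hrange, hcone⟩
  refine
    { pos := ?_
      injective := Subtype.val_injective.comp σ.injective
      mem_maximalCones := fun k => (σ k).2.1
      left_mem := fun k => hi _
      right_mem := fun k => hj _
      ne := fun k => hij _
      isPolyhedralCone_coneAt := fun k => ?_
      primary := fun k l hl μ hμ => ?_
      secondary := fun α β _ μ hμ => ?_
      boundary := ?_ }
  · obtain ⟨γ, hγ⟩ := hVne
    rw [hrange] at hγ
    obtain ⟨k, -⟩ := hγ
    exact k.pos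
  · rw [hcone _ (hρV _)]
    exact isPolyhedralCone_cell hv hV (hρV _)
  · exact (mem_cell_iff.1 (hsub _ hμ)).2.2 _ (hi _) _ (hj _) (hij _) rfl l hl
  · exact (mem_cell_iff.1 (hsub _ hμ)).2.1 _ (hρV _)
  · -- A cone with all the labels of `C l` lies in the cell of `l`, hence belongs to the system.
    intro l f _ _ D hD hDnot _
    by_contra! hcon
    obtain ⟨hprim, hsec⟩ := hcon
    apply hDnot
    have hDS : D ∈ S := by
      refine ⟨hD, _, hρV (σ l), fun μ hμ => mem_cell_iff.2 ⟨?_, ?_, ?_⟩⟩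
      · obtain ⟨e, -, rfl⟩ := mem_maximalCones_iff.1 hD
        exact hμ.1
      · intro γ' hγ'
        rw [hrange] at hγ'
        obtain ⟨β, rfl⟩ := hγ'
        exact hsec β μ hμ
      · intro a ha b hb hab hρ k hk
        rw [hφ.primary_congr hv ha hb (hi _) (hj _) hab (hij _) hρ, φ.shifted_congr hρ]
        exact hprim k hk μ hμ
    exact ⟨σ.symm ⟨D, hDS⟩, by simp⟩

end PolyhedralPolynomial

namespace PolyhedralPolynomial

variable {φ : PolyhedralPolynomial E} {v : E} {e e' p : StrongDual ℝ E} {u₀ : E}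

/-! ### Crossing a wall of the arrangement -/

/-- `p` is a point of the relative interior of a wall: the hyperplane of `u₀` is the only one of
the arrangement through `p`. (Several normals may define this hyperplane.) -/
structure IsWallPoint (φ : PolyhedralPolynomial E) (v : E) (u₀ : E) (p : StrongDual ℝ E) :
    Prop where
  mem_interior : p ∈ interior (normalCone φ.coeffSum v)
  normal_mem : u₀ ∈ φ.arrangementNormals v
  apply_eq_zero : p u₀ = 0
  exists_smul_eq : ∀ u ∈ φ.arrangementNormals v, p u = 0 → ∃ c : ℝ, u = c • u₀

/-- The chambers at a wall point all have the same intersection with the wall. -/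
theorem IsWallPoint.mem_chamber_iff (hp : φ.IsWallPoint v u₀ p) (he : φ.IsRegular v e)
    (hpe : p ∈ φ.chamber v e) {μ : StrongDual ℝ E} (hμ : μ u₀ = 0) :
    μ ∈ φ.chamber v e ↔ μ ∈ normalCone φ.coeffSum v ∧
      ∀ u ∈ φ.arrangementNormals v, p u ≠ 0 → 0 ≤ p u * μ u := by
  refine and_congr_right fun _ => forall₂_congr fun u hu => ?_
  by_cases hpu : p u = 0
  · obtain ⟨c, rfl⟩ := hp.exists_smul_eq u hu hpu
    simp [hμ]
  · have hpos : 0 < e u * p u := (hpe.2 u hu).lt_of_ne (mul_ne_zero (he.2 u hu) hpu).symm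
    simp only [ne_eq, hpu, not_false_eq_true, forall_true_left]
    rcases pos_and_pos_or_neg_and_neg_of_mul_pos hpos with ⟨h1, h2⟩ | ⟨h1, h2⟩
    · rw [mul_nonneg_iff_of_pos_left h1, mul_nonneg_iff_of_pos_left h2]
    · rw [← neg_mul_neg, ← neg_mul_neg (p u), mul_nonneg_iff_of_pos_left (neg_pos.2 h1),
        mul_nonneg_iff_of_pos_left (neg_pos.2 h2)]

/-- Two chambers at a wall point on the same side of the wall are equal. -/
theorem IsWallPoint.chamber_eq (hp : φ.IsWallPoint v u₀ p) (he : φ.IsRegular v e)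
    (he' : φ.IsRegular v e') (hpe : p ∈ φ.chamber v e) (hpe' : p ∈ φ.chamber v e')
    (hside : 0 < e u₀ * e' u₀) : φ.chamber v e = φ.chamber v e' := by
  refine chamber_congr fun u hu => ?_
  by_cases hpu : p u = 0
  · obtain ⟨c, rfl⟩ := hp.exists_smul_eq u hu hpu
    have hc : c ≠ 0 := by
      rintro rfl
      exact hu.1 (zero_smul _ _)
    simp only [map_smul, smul_eq_mul]
    calc 0 < c * c * (e u₀ * e' u₀) := mul_pos (mul_self_pos.2 hc) hside
      _ = _ := by ring
  · have h1 := (hpe.2 u hu).lt_of_ne (mul_ne_zero (he.2 u hu) hpu).symm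
    have h2 := (hpe'.2 u hu).lt_of_ne (mul_ne_zero (he'.2 u hu) hpu).symm
    have h3 : 0 < (p u * p u) * (e u * e' u) := by
      calc 0 < (e u * p u) * (e' u * p u) := mul_pos h1 h2
        _ = _ := by ring
    exact pos_of_mul_pos_right h3 (mul_self_nonneg _)

theorem finrank_strongDual_apply_eq_zero [FiniteDimensional ℝ E] {u : E} (hu : u ≠ 0) :
    Module.finrank ℝ (ContinuousLinearMap.apply ℝ ℝ u : StrongDual ℝ E →L[ℝ] ℝ).ker + 1 =
      Module.finrank ℝ E := by
  have h := LinearMap.finrank_range_add_finrank_ker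
    (ContinuousLinearMap.apply ℝ ℝ u : StrongDual ℝ E →L[ℝ] ℝ).toLinearMap
  have hrange : (ContinuousLinearMap.apply ℝ ℝ u : StrongDual ℝ E →L[ℝ] ℝ).toLinearMap.range =
      ⊤ := by
    refine LinearMap.range_eq_top.2 (LinearMap.surjective ?_)
    obtain ⟨f, -, hf⟩ := exists_dual_vector ℝ u (norm_ne_zero_iff.2 hu)
    intro h0
    have := LinearMap.congr_fun h0 f
    apply hu
    rw [← norm_eq_zero]
    simpa [hf] using this
  have hdim : Module.finrank ℝ (StrongDual ℝ E) = Module.finrank ℝ E := by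
    rw [← Subspace.dual_finrank_eq (K := ℝ) (V := E)]
    exact (LinearMap.toContinuousLinearMap (𝕜 := ℝ) (E := E) (F' := ℝ)).finrank_eq.symm
  rw [hrange, finrank_top, Module.finrank_self, hdim] at h
  rw [← h, add_comm]

/-- A chamber at a wall point meets the wall in a facet: near the wall point the intersection is
the whole hyperplane. -/
theorem IsWallPoint.isFacet [FiniteDimensional ℝ E] (hp : φ.IsWallPoint v u₀ p)
    (he : φ.IsRegular v e) (hpe : p ∈ φ.chamber v e) :
    IsFacet (φ.chamber v e) {μ ∈ φ.chamber v e | μ u₀ = 0} := by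
  refine ⟨⟨e u₀ • u₀, fun μ hμ => ?_, ?_⟩, ?_⟩
  · simpa using hμ.2 u₀ hp.normal_mem
  · ext μ
    simp [he.2 u₀ hp.normal_mem]
  · rw [← finrank_strongDual_apply_eq_zero hp.normal_mem.1]
    congr 1
    refine congrArg (fun K : Submodule ℝ (StrongDual ℝ E) => Module.finrank ℝ K) ?_
    refine le_antisymm (Submodule.span_le.2 fun μ hμ => by simpa using hμ.2) fun ν hν => ?_
    have hν0 : ν u₀ = 0 := by simpa using hν
    have hc : Filter.Tendsto (fun s : ℝ => p + s • ν) (nhdsWithin 0 (Set.Ioi 0)) (nhds p) := by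
      have : Continuous fun s : ℝ => p + s • ν := by fun_prop
      have := this.tendsto 0
      simp only [zero_smul, add_zero] at this
      exact this.mono_left nhdsWithin_le_nhds
    have hev : ∀ᶠ μ in nhds p, μ ∈ normalCone φ.coeffSum v ∧
        ∀ u ∈ φ.arrangementNormals v, p u ≠ 0 → 0 ≤ p u * μ u := by
      refine Filter.Eventually.and (mem_interior_iff_mem_nhds.1 hp.mem_interior) ?_
      rw [(φ.finite_arrangementNormals v).eventually_all]
      intro u _
      by_cases hpu : p u = 0
      · simp [hpu]
      have hcu : Continuous fun μ : StrongDual ℝ E => p u * μ u :=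
        continuous_const.mul (ContinuousLinearMap.apply ℝ ℝ u).continuous
      exact ((hcu.tendsto p).eventually (lt_mem_nhds (mul_self_pos.2 hpu))).mono
        fun _ h _ => h.le
    obtain ⟨s, hs, hs0⟩ := ((hc.eventually hev).and self_mem_nhdsWithin).exists
    have hs0 : s ≠ 0 := ne_of_gt hs0
    have hzero : (p + s • ν) u₀ = 0 := by simp [hp.apply_eq_zero, hν0]
    have hmem : p + s • ν ∈ {μ ∈ φ.chamber v e | μ u₀ = 0} :=
      ⟨(hp.mem_chamber_iff he hpe hzero).2 hs, hzero⟩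
    have hsub := Submodule.sub_mem _ (Submodule.subset_span (R := ℝ) hmem)
      (Submodule.subset_span (R := ℝ) (s := {μ ∈ φ.chamber v e | μ u₀ = 0})
        ⟨hpe, hp.apply_eq_zero⟩)
    rw [add_sub_cancel_left] at hsub
    exact (Submodule.smul_mem_iff _ hs0).1 hsub

theorem IsLocalCompatibleSystem.range_subset_rhoSet {t : ℕ} {C : Fin t → Set (StrongDual ℝ E)}
    {i j : Fin t → ℕ} (h : φ.IsLocalCompatibleSystem v C i j) :
    Set.range (fun k => φ.rho v (i k) (j k)) ⊆ φ.rhoSet v := by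
  rintro _ ⟨k, rfl⟩
  exact ⟨_, h.left_mem k, _, h.right_mem k, h.ne k, rfl⟩

theorem IsLocalCompatibleSystem.coneAt_subset_cell (hφ : φ.IsGeneric)
    (hv : v ∈ vertexSet φ.coeffSum) {t : ℕ} {C : Fin t → Set (StrongDual ℝ E)}
    {i j : Fin t → ℕ} (h : φ.IsLocalCompatibleSystem v C i j) (γ : E) :
    φ.coneAt v C i j γ ⊆ φ.cell v (Set.range fun k => φ.rho v (i k) (j k)) γ := by
  intro μ hμ
  obtain ⟨k, rfl, hμk⟩ := mem_coneAt_iff.1 hμ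
  refine mem_cell_iff.2 ⟨?_, ?_, ?_⟩
  · obtain ⟨e, -, he⟩ := mem_maximalCones_iff.1 (h.mem_maximalCones k)
    rw [he] at hμk
    exact hμk.1
  · rintro _ ⟨β, rfl⟩
    rcases eq_or_ne k β with rfl | hne
    exacts [le_rfl, h.secondary k β hne μ hμk]
  · intro a ha b hb hab hρ l hl
    rw [hφ.primary_congr hv ha hb (h.left_mem k) (h.right_mem k) hab (h.ne k) hρ,
      φ.shifted_congr hρ]
    exact h.primary k l hl μ hμk

theorem IsLocalCompatibleSystem.isClosed_coneAt {t : ℕ} {C : Fin t → Set (StrongDual ℝ E)}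
    {i j : Fin t → ℕ} (h : φ.IsLocalCompatibleSystem v C i j) (γ : E) :
    IsClosed (φ.coneAt v C i j γ) :=
  isClosed_iUnion_of_finite fun k => isClosed_iUnion_of_finite fun _ =>
    isClosed_of_mem_maximalCones (h.mem_maximalCones k)

/-- The cones of a compatible system fill the cells: otherwise a generic segment inside a cell
leaves the system through a wall, and the cone beyond that wall has all the labels that the
boundary condition excludes. -/
theorem IsLocalCompatibleSystem.coneAt_eq_cell [FiniteDimensional ℝ E] (hφ : φ.IsGeneric)
    (hv : v ∈ vertexSet φ.coeffSum) {t : ℕ} {C : Fin t → Set (StrongDual ℝ E)}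
    {i j : Fin t → ℕ} (h : φ.IsLocalCompatibleSystem v C i j) {γ : E}
    (hγ : γ ∈ Set.range fun k => φ.rho v (i k) (j k)) :
    φ.coneAt v C i j γ = φ.cell v (Set.range fun k => φ.rho v (i k) (j k)) γ := by
  refine (h.coneAt_subset_cell hφ hv γ).antisymm fun x hx => ?_
  by_contra hxnot
  have hV := h.range_subset_rhoSet
  obtain ⟨k₀, hk₀⟩ := id hγ
  obtain ⟨a, ha, hCa⟩ := mem_maximalCones_iff.1 (h.mem_maximalCones k₀)
  have hacone : φ.chamber v a ⊆ φ.coneAt v C i j γ := fun μ hμ =>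
    mem_coneAt_iff.2 ⟨k₀, hk₀, by rwa [hCa]⟩
  have hfull : (interior (φ.cell v (Set.range fun k => φ.rho v (i k) (j k)) γ)).Nonempty :=
    ⟨a, interior_mono (hacone.trans (h.coneAt_subset_cell hφ hv γ)) ha.mem_interior_chamber⟩
  -- The endpoint `b` is such that the segment meets no two distinct hyperplanes at once.
  have hUfin : ((fun w : E × E => a w.1 • w.2 - a w.2 • w.1) ''
      (φ.arrangementNormals v ×ˢ φ.arrangementNormals v)).Finite :=
    ((φ.finite_arrangementNormals v).prod (φ.finite_arrangementNormals v)).image _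
  obtain ⟨b, hbcell, hbO, hb, hbU⟩ := exists_mem_interior_cell hv hV hγ hfull hx
    (h.isClosed_coneAt γ).isOpen_compl hxnot hUfin
  let c : ℝ → StrongDual ℝ E := fun s => (1 - s) • a + s • b
  have hcont : Continuous c := by fun_prop
  have hcapp : ∀ s u, c s u = (1 - s) * a u + s * b u := fun s u => by simp [c]
  have hcint : ∀ s ∈ Set.Icc (0 : ℝ) 1, c s ∈ interior (normalCone φ.coeffSum v) := fun s hs =>
    (convex_normalCone _ _).interior ha.1 hb.1 (by linarith [hs.2]) hs.1 (by ring)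
  have hccell : ∀ s ∈ Set.Icc (0 : ℝ) 1,
      c s ∈ φ.cell v (Set.range fun k => φ.rho v (i k) (j k)) γ := fun s hs =>
    (isPolyhedralCone_cell hv hV hγ).convex
      (h.coneAt_subset_cell hφ hv γ (hacone ha.mem_chamber)) (interior_subset hbcell)
      (by linarith [hs.2]) hs.1 (by ring)
  -- The last parameter at which the segment is in the system.
  obtain ⟨s₀, ⟨hs₀I, hs₀⟩, hlast⟩ := (isCompact_Icc.inter_right
    ((h.isClosed_coneAt γ).preimage hcont)).exists_isGreatest
    (show (Set.Icc (0 : ℝ) 1 ∩ c ⁻¹' φ.coneAt v C i j γ).Nonempty from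
      ⟨0, ⟨le_rfl, zero_le_one⟩, by simpa [c] using hacone ha.mem_chamber⟩)
  have hs₀1 : s₀ < 1 := by
    refine hs₀I.2.lt_of_ne ?_
    rintro rfl
    exact hbO (by simpa [c] using hs₀)
  obtain ⟨k, hk, hpk⟩ := mem_coneAt_iff.1 hs₀
  obtain ⟨ek, hek, hCk⟩ := mem_maximalCones_iff.1 (h.mem_maximalCones k)
  rw [hCk] at hpk
  set p := c s₀ with hpdef
  -- A regular point `q` just beyond `p`.
  obtain ⟨s₁, hs₁, hs₁lt, hs₁1⟩ : ∃ s₁, (∀ u ∈ φ.arrangementNormals v, p u ≠ 0 →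
      0 < p u * c s₁ u) ∧ s₀ < s₁ ∧ s₁ < 1 := by
    have hev : ∀ᶠ s in nhds s₀, ∀ u ∈ φ.arrangementNormals v, p u ≠ 0 → 0 < p u * c s u := by
      rw [(φ.finite_arrangementNormals v).eventually_all]
      intro u _
      by_cases hpu : p u = 0
      · simp [hpu]
      have hcu : Continuous fun s => p u * c s u := by
        simp only [hcapp]; fun_prop
      exact ((hcu.tendsto s₀).eventually (lt_mem_nhds (mul_self_pos.2 hpu))).mono fun _ h _ => h
    have hlt : ∀ᶠ s in nhdsWithin s₀ (Set.Ioi s₀), s < 1 :=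
      (gt_mem_nhds hs₀1).filter_mono nhdsWithin_le_nhds
    obtain ⟨s₁, ⟨h1, h2⟩, h3⟩ :=
      (((hev.filter_mono nhdsWithin_le_nhds).and hlt).and self_mem_nhdsWithin).exists
    exact ⟨s₁, h1, h3, h2⟩
  have hs₁I : s₁ ∈ Set.Icc (0 : ℝ) 1 := ⟨hs₀I.1.trans hs₁lt.le, hs₁1.le⟩
  set q := c s₁ with hqdef
  have hq : φ.IsRegular v q := by
    refine ⟨hcint s₁ hs₁I, fun u hu hqu => ?_⟩
    by_cases hpu : p u = 0
    · apply ha.2 u hu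
      rw [hpdef, hcapp] at hpu
      rw [hqdef, hcapp] at hqu
      have h1 : (s₁ - s₀) * (b u - a u) = 0 := by linarith
      have h2 := (mul_eq_zero.1 h1).resolve_left (sub_ne_zero.2 hs₁lt.ne')
      have h3 : b u = a u := sub_eq_zero.1 h2
      rw [h3] at hpu
      linarith
    · have := hs₁ u hu hpu
      rw [hqu, mul_zero] at this
      exact lt_irrefl _ this
  have hqnot : q ∉ φ.coneAt v C i j γ := fun hmem => absurd (hlast ⟨hs₁I, hmem⟩) hs₁lt.not_ge
  have hqcell := hccell s₁ hs₁I
  have hqk : φ.chamber v q ≠ φ.chamber v ek := fun heq =>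
    hqnot (mem_coneAt_iff.2 ⟨k, hk, by rw [hCk, ← heq]; exact hq.mem_chamber⟩)
  have hpq : p ∈ φ.chamber v q := by
    refine ⟨hpk.1, fun u hu => ?_⟩
    by_cases hpu : p u = 0
    · simp [hpu]
    · rw [mul_comm]; exact (hs₁ u hu hpu).le
  obtain ⟨u₀, hu₀, hpu₀⟩ : ∃ u₀ ∈ φ.arrangementNormals v, p u₀ = 0 := by
    by_contra! hcon
    have hpreg : φ.IsRegular v p := ⟨hcint s₀ hs₀I, hcon⟩
    exact hqk ((hq.chamber_eq_of_mem hpreg hpq).symm.trans (hek.chamber_eq_of_mem hpreg hpk))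
  have hwall : φ.IsWallPoint v u₀ p := by
    refine ⟨hcint s₀ hs₀I, hu₀, hpu₀, fun u hu hpu => ?_⟩
    have hw : a u₀ • u - a u • u₀ = 0 := by
      by_contra hne
      apply hbU _ ⟨(u₀, u), ⟨hu₀, hu⟩, rfl⟩ hne
      rw [hpdef, hcapp] at hpu hpu₀
      have h1 : (1 - s₀) * (a u₀ * b u - a u * b u₀) = 0 := by
        linear_combination b u * hpu₀ - b u₀ * hpu
      have h2 := (mul_eq_zero.1 h1).resolve_left (by linarith)
      simpa using h2
    refine ⟨(a u₀)⁻¹ * a u, ?_⟩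
    rw [mul_smul, ← sub_eq_zero.1 hw, smul_smul, inv_mul_cancel₀ (ha.2 u₀ hu₀), one_smul]
  -- The cones of `ek` and `q` lie on opposite sides of the wall and share it as a facet.
  have hopp : ek u₀ * q u₀ < 0 := by
    by_contra! hge
    have hpos := hge.lt_of_ne (mul_ne_zero (hek.2 u₀ hu₀) (hq.2 u₀ hu₀)).symm
    exact hqk (hwall.chamber_eq hek hq hpk hpq hpos).symm
  have hDnot : φ.chamber v q ∉ Set.range C := by
    rintro ⟨β, hβ⟩
    have hqβ : q ∈ φ.coneAt v C i j (φ.rho v (i β) (j β)) :=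
      mem_coneAt_iff.2 ⟨β, rfl, by rw [hβ]; exact hq.mem_chamber⟩
    have heq := hq.eq_of_mem_cell hV ⟨β, rfl⟩ hγ (h.coneAt_subset_cell hφ hv _ hqβ) hqcell
    exact hqnot (heq ▸ hqβ)
  have hface : {μ ∈ φ.chamber v ek | μ u₀ = 0} = {μ ∈ φ.chamber v q | μ u₀ = 0} := by
    ext μ
    refine and_congr_left fun hμ => ?_
    rw [hwall.mem_chamber_iff hek hpk hμ, hwall.mem_chamber_iff hq hpq hμ]
  have hsubset := hq.chamber_subset_cell hV hγ hqcell
  have hbd := h.boundary k {μ ∈ φ.chamber v ek | μ u₀ = 0}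
    (by rw [hCk]; exact hwall.isFacet hek hpk) ?_ (φ.chamber v q)
    (mem_maximalCones_iff.2 ⟨q, hq, rfl⟩) hDnot
    (by rw [hface]; exact hwall.isFacet hq hpq)
  · rcases hbd with hprim | ⟨β, hsec⟩
    · exact hprim fun l hl μ hμ => (mem_cell_iff.1 (hsubset hμ)).2.2 _ (h.left_mem k) _
        (h.right_mem k) (h.ne k) hk l hl
    · refine hsec fun μ hμ => ?_
      rw [hk]
      exact (mem_cell_iff.1 (hsubset hμ)).2.1 _ ⟨β, rfl⟩
  · rintro k' ⟨⟨y, -, hy⟩, -⟩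
    obtain ⟨e', he', hCk'⟩ := mem_maximalCones_iff.1 (h.mem_maximalCones k')
    have hpk' : p ∈ φ.chamber v e' := by
      have : p ∈ {μ ∈ φ.chamber v ek | μ u₀ = 0} := ⟨hpk, hpu₀⟩
      rw [hy, hCk'] at this
      exact this.1
    rcases (mul_ne_zero (he'.2 u₀ hu₀) (hek.2 u₀ hu₀)).lt_or_gt with hlt | hgt
    · refine absurd ⟨k', ?_⟩ hDnot
      rw [hCk']
      refine hwall.chamber_eq he' hq hpk' hpq ?_
      have h1 : 0 < (ek u₀ * ek u₀) * (e' u₀ * q u₀) := by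
        calc 0 < (e' u₀ * ek u₀) * (ek u₀ * q u₀) := mul_pos_of_neg_of_neg hlt hopp
          _ = _ := by ring
      exact pos_of_mul_pos_right h1 (mul_self_nonneg _)
    · apply h.injective
      rw [hCk', hCk]
      exact hwall.chamber_eq he' hek hpk' hpk hgt

end PolyhedralPolynomial

namespace PolyhedralPolynomial

variable {φ : PolyhedralPolynomial E} {v : E} {P : Set E}

/-! ### Local solutions -/

theorem add_smul_mem_summand {k : ℕ} {q γ : E} (hq : q ∈ φ.coeff k) (hγ : γ ∈ P) :
    q + (k : ℝ) • γ ∈ φ.summand k P := by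
  refine Set.add_mem_add hq ((Set.mem_finsetSum (t := Finset.range k) (f := fun _ => P) _).2
    ⟨fun _ => γ, fun _ => hγ, ?_⟩)
  rw [Finset.sum_const, Finset.card_range, Nat.cast_smul_eq_nsmul]

theorem normalCone_inter_subset_normalCone_summand (k : ℕ) (q γ : E) :
    normalCone (φ.coeff k) q ∩ normalCone P γ ⊆
      normalCone (φ.summand k P) (q + (k : ℝ) • γ) := by
  rintro μ ⟨hμq, hμγ⟩ x hx
  obtain ⟨y, hy, z, hz, rfl⟩ := Set.mem_add.1 hx
  obtain ⟨g, hg, rfl⟩ := (Set.mem_finsetSum (t := Finset.range k) (f := fun _ => P) z).1 hz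
  rw [map_add, map_add, map_smul, map_sum, smul_eq_mul]
  refine add_le_add (hμq y hy) ?_
  calc (k : ℝ) * μ γ = ∑ _i ∈ Finset.range k, μ γ := by simp
    _ ≤ _ := Finset.sum_le_sum fun i hi => hμγ _ (hg hi)

theorem summand_subset_eval {k : ℕ} (hk : k ∈ φ.supp) : φ.summand k P ⊆ φ.eval P :=
  (Set.subset_biUnion_of_mem (u := fun k => φ.summand k P) (Finset.mem_coe.2 hk)).trans
    ((subset_convexHull ℝ _).trans subset_closure)

theorem mem_normalCone_eval {w : E} {μ : StrongDual ℝ E}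
    (h : ∀ k ∈ φ.supp, μ ∈ normalCone (φ.summand k P) w) : μ ∈ normalCone (φ.eval P) w := by
  have hsub : φ.eval P ⊆ {x | μ w ≤ μ x} := by
    refine closure_minimal (convexHull_min (Set.iUnion₂_subset fun k hk => h k hk) ?_)
      (isClosed_le continuous_const μ.continuous)
    exact convex_halfSpace_ge μ.toLinearMap.isLinear _
  exact hsub

theorem normalCone_coeffSum_subset (hv : v ∈ vertexSet φ.coeffSum) {k : ℕ} (hk : k ∈ φ.supp) :
    normalCone φ.coeffSum v ⊆ normalCone (φ.coeff k) (φ.component v k) := by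
  rw [φ.normalCone_coeffSum hv]
  exact Set.biInter_subset_of_mem (Finset.mem_coe.2 hk)

theorem component_add_smul_mem_summand (hv : v ∈ vertexSet φ.coeffSum) {γ : E} (hγ : γ ∈ P)
    {k : ℕ} (hk : k ∈ φ.supp) : φ.component v k + (k : ℝ) • γ ∈ φ.summand k P :=
  add_smul_mem_summand ((φ.isDecomposition_component hv).1 k hk).1 hγ

/-- At a functional in general position in the normal cone of a vertex `γ`, the least of the points
`v_k + k γ` is a vertex of `φ(P)`; since it is a vertex of two summands, it comes from two
indices, whose point is therefore `γ`. -/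
theorem IsLocalSolution.exists_primary (hv : v ∈ vertexSet φ.coeffSum) (h : φ.IsLocalSolution v P)
    {γ : E} (hγ : γ ∈ vertexSet P) {μ : StrongDual ℝ E} (hμ : μ ∈ interior (normalCone P γ))
    (hoff : ∀ k ∈ φ.supp, ∀ m ∈ φ.supp, φ.component v k + (k : ℝ) • γ ≠
      φ.component v m + (m : ℝ) • γ →
      μ (φ.component v k + (k : ℝ) • γ) ≠ μ (φ.component v m + (m : ℝ) • γ)) :
    ∃ l ∈ φ.supp, ∃ m ∈ φ.supp, l ≠ m ∧ φ.rho v l m = γ ∧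
      ∀ k ∈ φ.supp, μ (φ.shifted v l m l) ≤ μ (φ.shifted v l m k) := by
  set p : ℕ → E := fun k => φ.component v k + (k : ℝ) • γ with hp
  have hsubset : ∀ k ∈ φ.supp, normalCone P γ ⊆ normalCone (φ.summand k P) (p k) :=
    fun k hk ν hν => normalCone_inter_subset_normalCone_summand k _ _
      ⟨normalCone_coeffSum_subset hv hk (h.2 (normalCone_subset_normalSupport hγ hν)), hν⟩
  have hpmem : ∀ k ∈ φ.supp, p k ∈ φ.summand k P := fun k hk =>
    component_add_smul_mem_summand hv hγ.1 hk
  obtain ⟨k₀, hk₀, hmin⟩ := Finset.exists_min_image φ.supp (fun k => μ (p k)) φ.supp_nonempty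
  have hint : μ ∈ interior (normalCone (φ.eval P) (p k₀)) := by
    rw [mem_interior_iff_mem_nhds]
    have hev : ∀ᶠ ν in nhds μ, ∀ k ∈ φ.supp, ν (p k₀) ≤ ν (p k) := by
      rw [Filter.eventually_all_finset]
      intro k hk
      by_cases heq : p k₀ = p k
      · simp [heq]
      · have hlt := (hmin k hk).lt_of_ne (hoff k₀ hk₀ k hk heq)
        exact (((ContinuousLinearMap.apply ℝ ℝ (p k₀)).continuous.tendsto μ).eventually_lt
          ((ContinuousLinearMap.apply ℝ ℝ (p k)).continuous.tendsto μ) hlt).mono fun _ h => h.le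
    filter_upwards [hev, mem_interior_iff_mem_nhds.1 hμ] with ν hν hνγ
    exact mem_normalCone_eval fun k hk x hx => (hν k hk).trans (hsubset k hk hνγ x hx)
  have hw : p k₀ ∈ vertexSet (φ.eval P) :=
    ⟨summand_subset_eval hk₀ (hpmem k₀ hk₀), μ,
      fun x hx hne => apply_lt_of_mem_interior_normalCone hint hx hne⟩
  obtain ⟨l, hl, m, hm, hlm, hwl, hwm⟩ := h.1.2.2 _ hw
  have heq : ∀ k ∈ φ.supp, p k₀ ∈ vertexSet (φ.summand k P) → p k₀ = p k := by
    intro k hk hmem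
    by_contra hne
    have := apply_lt_of_mem_interior_normalCone (interior_mono (hsubset k hk) hμ) hmem.1 hne
    exact absurd (hmin k hk) this.not_ge
  have hρ : φ.rho v l m = γ :=
    φ.eq_rho_of_add_smul_eq hlm ((heq l hl hwl).symm.trans (heq m hm hwm))
  refine ⟨l, hl, m, hm, hlm, hρ, fun k hk => ?_⟩
  rw [shifted, shifted, hρ]
  have := hmin k hk
  rw [heq l hl hwl] at this
  exact this

/-- The functionals interior to the normal cone of a vertex `γ` that separate the points `v_k + k γ`
are dense in the normal cone. -/
theorem IsLocalSolution.exists_general_position [FiniteDimensional ℝ E]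
    (h : φ.IsLocalSolution v P)
    {γ : E} (hγ : γ ∈ vertexSet P) {O : Set (StrongDual ℝ E)} (hO : IsOpen O)
    (hne : (O ∩ normalCone P γ).Nonempty) : ∃ μ ∈ interior (normalCone P γ), μ ∈ O ∧
      ∀ k ∈ φ.supp, ∀ m ∈ φ.supp, φ.component v k + (k : ℝ) • γ ≠
      φ.component v m + (m : ℝ) • γ →
      μ (φ.component v k + (k : ℝ) • γ) ≠ μ (φ.component v m + (m : ℝ) • γ) := by
  obtain ⟨x, hxO, hx⟩ := hne
  obtain ⟨μ, hμ, hμO, hoff⟩ := exists_mem_interior_forall_apply_ne_zero (convex_normalCone P γ)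
    (h.1.1.interior_normalCone_nonempty hγ) hx hO hxO
    ((φ.supp ×ˢ φ.supp).finite_toSet.image fun a : ℕ × ℕ =>
      (φ.component v a.1 + (a.1 : ℝ) • γ) - (φ.component v a.2 + (a.2 : ℝ) • γ))
  refine ⟨μ, hμ, hμO, fun k hk m hm hkm heq => ?_⟩
  refine hoff _ ⟨(k, m), by simp [hk, hm], rfl⟩ (sub_ne_zero.2 hkm) ?_
  rw [map_sub, heq, sub_self]

theorem IsLocalSolution.vertexSet_subset_rhoSet [FiniteDimensional ℝ E]
    (hv : v ∈ vertexSet φ.coeffSum)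
    (h : φ.IsLocalSolution v P) : vertexSet P ⊆ φ.rhoSet v := by
  intro γ hγ
  obtain ⟨ℓ, hℓ⟩ := h.1.1.interior_normalCone_nonempty hγ
  obtain ⟨μ, hμ, -, hoff⟩ :=
    h.exists_general_position hγ isOpen_univ ⟨ℓ, trivial, interior_subset hℓ⟩
  obtain ⟨l, hl, m, hm, hlm, hρ, -⟩ := h.exists_primary hv hγ hμ hoff
  exact ⟨l, hl, m, hm, hlm, hρ⟩

/-- The primary inequalities hold at a dense set of functionals in the normal cone, and the cell is
closed. -/
theorem IsLocalSolution.normalCone_subset_cell [FiniteDimensional ℝ E] (hφ : φ.IsGeneric)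
    (hv : v ∈ vertexSet φ.coeffSum)
    (h : φ.IsLocalSolution v P) {γ : E} (hγ : γ ∈ vertexSet P) :
    normalCone P γ ⊆ φ.cell v (vertexSet P) γ := by
  intro x hx
  by_contra hcon
  have hclosed := (isPolyhedralCone_cell hv (h.vertexSet_subset_rhoSet hv) hγ).isClosed
  obtain ⟨μ, hμ, hμO, hoff⟩ := h.exists_general_position hγ hclosed.isOpen_compl ⟨x, hcon, hx⟩
  obtain ⟨l, hl, m, hm, hlm, hρ, hprim⟩ := h.exists_primary hv hγ hμ hoff
  have hμγ := interior_subset hμ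
  refine hμO (mem_cell_iff.2 ⟨h.2 (normalCone_subset_normalSupport hγ hμγ),
    fun γ' hγ' => hμγ γ' hγ'.1, fun i hi j hj hij hρ' k hk => ?_⟩)
  rw [hφ.primary_congr hv hi hj hl hm hij hlm (hρ'.trans hρ.symm),
    φ.shifted_congr (hρ'.trans hρ.symm)]
  exact hprim k hk

/-- A functional exposing a vertex of `φ(P)` is minimised over `P` at some vertex `γ = ρ_{i,j}`, and the
primary inequalities make `v_i + i γ = v_j + j γ` the exposed vertex. -/
theorem isLocalSolution_of_normalCone_subset_cell (hv : v ∈ vertexSet φ.coeffSum)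
    (hP : IsPolyhedron P) (hne : (vertexSet P).Nonempty) (hV : vertexSet P ⊆ φ.rhoSet v)
    (hcell : ∀ γ ∈ vertexSet P, normalCone P γ ⊆ φ.cell v (vertexSet P) γ) :
    φ.IsLocalSolution v P := by
  have hlocal : normalSupport P ⊆ normalCone φ.coeffSum v :=
    Set.iUnion₂_subset fun γ hγ μ hμ => (hcell γ hγ hμ).1
  refine ⟨⟨hP, hne, ?_⟩, hlocal⟩
  rintro w ⟨hw, μ, hμ⟩
  have hle : ∀ x ∈ φ.eval P, μ w ≤ μ x := fun x hx => by
    rcases eq_or_ne x w with rfl | hxw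
    exacts [le_rfl, (hμ x hx hxw).le]
  have hsupp : μ ∈ normalSupport P := by
    rw [hP.mem_normalSupport_iff hne]
    intro u hu
    obtain ⟨γ, hγ⟩ := hne
    -- A summand of positive degree recedes along `u`.
    obtain ⟨k, hk, hkpos⟩ : ∃ k ∈ φ.supp, 0 < k := by
      obtain ⟨i, hi, j, hj, hij, -⟩ := hV hγ
      rcases Nat.eq_zero_or_pos i with rfl | h
      exacts [⟨j, hj, Nat.pos_of_ne_zero hij.symm⟩, ⟨i, hi, h⟩]
    by_contra! hneg
    set a := μ (φ.component v k + (k : ℝ) • γ) with ha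
    have h0 : μ w ≤ a := hle _ (summand_subset_eval hk (component_add_smul_mem_summand hv hγ.1 hk))
    set s := (a - μ w + 1) / (-μ u) with hs
    have hs0 : 0 ≤ s := div_nonneg (by linarith) (by linarith)
    have hsu : s * μ u = -(a - μ w + 1) := by
      have := hneg.ne
      rw [hs]; field_simp
    have h1 := hle _ (summand_subset_eval hk
      (component_add_smul_mem_summand hv (hu γ hγ.1 s hs0) hk))
    have h2 : μ (φ.component v k + (k : ℝ) • (γ + s • u)) = a + k * (s * μ u) := by
      rw [ha]
      simp only [map_add, map_smul, smul_eq_mul]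
      ring
    have hk1 : (1 : ℝ) ≤ k := by exact_mod_cast hkpos
    rw [h2, hsu] at h1
    nlinarith
  simp only [normalSupport, Set.mem_iUnion] at hsupp
  obtain ⟨γ, hγ, hμγ⟩ := hsupp
  obtain ⟨i, hi, j, hj, hij, hρ⟩ := hV hγ
  have hμcell := mem_cell_iff.1 (hcell γ hγ hμγ)
  have hmin : μ ∈ normalCone (φ.eval P) (φ.shifted v i j i) :=
    mem_normalCone_eval fun k hk x hx =>
      (hμcell.2.2 i hi j hj hij hρ k hk).trans (by
        rw [shifted, hρ]
        exact normalCone_inter_subset_normalCone_summand k _ _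
          ⟨normalCone_coeffSum_subset hv hk hμcell.1, hμγ⟩ x hx)
  have hwi : w = φ.shifted v i j i := by
    by_contra hne'
    have hmem : φ.shifted v i j i ∈ φ.eval P := by
      rw [shifted, hρ]
      exact summand_subset_eval hi (component_add_smul_mem_summand hv hγ.1 hi)
    exact absurd (hmin w hw) (hμ _ hmem (Ne.symm hne')).not_ge
  have hvert : ∀ k ∈ φ.supp, w = φ.shifted v i j k → w ∈ vertexSet (φ.summand k P) := by
    intro k hk hwk
    refine ⟨?_, μ, fun x hx hxw => hμ x (summand_subset_eval hk hx) hxw⟩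
    rw [hwk, shifted, hρ]
    exact component_add_smul_mem_summand hv hγ.1 hk
  exact ⟨i, hi, j, hj, hij, hvert i hi hwi,
    hvert j hj (hwi.trans (φ.shifted_left_eq_right v hij))⟩

/-- In a polyhedral cone covered by the cells, the part on which `γ` is the least point of `V`
belongs to the cell of `γ`. -/
theorem setOf_le_subset_cell [FiniteDimensional ℝ E] (hv : v ∈ vertexSet φ.coeffSum)
    {V : Set E} (hV : V ⊆ φ.rhoSet v)
    {K : Set (StrongDual ℝ E)} (hK : IsPolyhedralCone K) (hKV : K ⊆ ⋃ γ ∈ V, φ.cell v V γ)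
    {γ : E} (hγ : γ ∈ V) (hfull : (interior {μ ∈ K | ∀ γ' ∈ V, μ γ ≤ μ γ'}).Nonempty) :
    {μ ∈ K | ∀ γ' ∈ V, μ γ ≤ μ γ'} ⊆ φ.cell v V γ := by
  intro x hx
  by_contra hcon
  have hVfin := (φ.finite_rhoSet v).subset hV
  obtain ⟨b, hb, hbO, hoff⟩ := exists_mem_interior_forall_apply_ne_zero
    (isPolyhedralCone_setOf_le hK hVfin γ).convex hfull hx
    (isPolyhedralCone_cell hv hV hγ).isClosed.isOpen_compl hcon (hVfin.image fun γ' => γ' - γ)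
  have hb := interior_subset hb
  obtain ⟨γ', hγ', hbγ'⟩ := Set.mem_iUnion₂.1 (hKV hb.1)
  have hne : γ' ≠ γ := by
    rintro rfl
    exact hbO hbγ'
  refine hoff _ ⟨γ', hγ', rfl⟩ (sub_ne_zero.2 hne) ?_
  rw [map_sub, sub_eq_zero]
  exact le_antisymm ((mem_cell_iff.1 hbγ').2.1 γ hγ) (hb.2 γ' hγ')

/-- Every polyhedral cone between the normal support of a local solution and the union of the cells
is the normal support of a local solution with the same vertices. -/
theorem IsLocalSolution.exists_normalSupport_eq [FiniteDimensional ℝ E]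
    (hv : v ∈ vertexSet φ.coeffSum) (h : φ.IsLocalSolution v P) {K : Set (StrongDual ℝ E)}
    (hK : IsPolyhedralCone K) (hPK : normalSupport P ⊆ K)
    (hKV : K ⊆ ⋃ γ ∈ vertexSet P, φ.cell v (vertexSet P) γ) :
    ∃ P', φ.IsLocalSolution v P' ∧ vertexSet P' = vertexSet P ∧ normalSupport P' = K := by
  have hV := h.vertexSet_subset_rhoSet hv
  have hVfin := (φ.finite_rhoSet v).subset hV
  have hfull : ∀ γ ∈ vertexSet P,
      (interior {μ ∈ K | ∀ γ' ∈ vertexSet P, μ γ ≤ μ γ'}).Nonempty := fun γ hγ =>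
    (h.1.1.interior_normalCone_nonempty hγ).mono (interior_mono fun μ hμ =>
      ⟨hPK (normalCone_subset_normalSupport hγ hμ), fun γ' hγ' => hμ γ' hγ'.1⟩)
  obtain ⟨P', hP', hvert, hnormal⟩ := exists_isPolyhedron_normalCone_eq hK hVfin h.1.2.1 hfull
  refine ⟨P', ?_, hvert, ?_⟩
  · refine isLocalSolution_of_normalCone_subset_cell hv hP' (by rw [hvert]; exact h.1.2.1)
      (by rw [hvert]; exact hV) fun γ hγ => ?_
    rw [hvert] at hγ ⊢
    rw [hnormal γ hγ]
    exact setOf_le_subset_cell hv hV hK hKV hγ (hfull γ hγ)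
  · refine Set.Subset.antisymm (Set.iUnion₂_subset fun γ hγ => ?_) fun μ hμ => ?_
    · rw [hvert] at hγ
      rw [hnormal γ hγ]
      exact fun μ hμ => hμ.1
    · obtain ⟨γ, hγ, hmin⟩ := Set.exists_min_image _ μ hVfin h.1.2.1
      refine normalCone_subset_normalSupport (by rwa [hvert]) (p := γ) ?_
      rw [hnormal γ hγ]
      exact ⟨hμ, hmin⟩

theorem iUnion_eq_biUnion_coneAt {t : ℕ} (C : Fin t → Set (StrongDual ℝ E)) (i j : Fin t → ℕ) :
    ⋃ k, C k = ⋃ γ ∈ Set.range fun k => φ.rho v (i k) (j k), φ.coneAt v C i j γ := by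
  ext μ
  simp only [Set.mem_iUnion, mem_coneAt_iff, Set.mem_range, exists_prop]
  exact ⟨fun ⟨k, hk⟩ => ⟨_, ⟨k, rfl⟩, k, rfl, hk⟩, fun ⟨_, _, k, _, hk⟩ => ⟨k, hk⟩⟩

/-! ### Minimal local solutions and compatible systems -/

theorem IsMinimalLocalSolution.exists_isLocalCompatibleSystem [FiniteDimensional ℝ E] (hφ : φ.IsGeneric)
    (hv : v ∈ vertexSet φ.coeffSum) (hmin : φ.IsMinimalLocalSolution v P) :
    ∃ (t : ℕ) (C : Fin t → Set (StrongDual ℝ E)) (i j : Fin t → ℕ),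
      φ.IsLocalCompatibleSystem v C i j ∧
      vertexSet P = Set.range (fun k => φ.rho v (i k) (j k)) ∧
      ∃ L, IsMaximalPolyhedralSubcone (⋃ k, C k) L ∧ φ.IsAssociatedPolyhedron v C i j L P := by
  obtain ⟨h, hrec⟩ := hmin
  obtain ⟨⟨hP, hne, -⟩, -⟩ := id h
  have hV := h.vertexSet_subset_rhoSet hv
  have hcell := fun γ (hγ : γ ∈ vertexSet P) => h.normalCone_subset_cell hφ hv hγ
  obtain ⟨t, C, i, j, hsys, hrange, hcone⟩ := PolyhedralPolynomial.exists_isLocalCompatibleSystem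
    hφ hv hV hne
    fun γ hγ => (hP.interior_normalCone_nonempty hγ).mono (interior_mono (hcell γ hγ))
  have hunion : ⋃ k, C k = ⋃ γ ∈ vertexSet P, φ.cell v (vertexSet P) γ := by
    rw [iUnion_eq_biUnion_coneAt (φ := φ) (v := v) C i j, ← hrange]
    exact Set.iUnion₂_congr hcone
  have hsub : ∀ γ ∈ vertexSet P,
      normalCone P γ ⊆ φ.coneAt v C i j γ ∩ normalSupport P := fun γ hγ =>
    Set.subset_inter (by rw [hcone γ hγ]; exact hcell γ hγ) (normalCone_subset_normalSupport hγ)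
  refine ⟨t, C, i, j, hsys, hrange, normalSupport P,
    ⟨⟨hP.isPolyhedralCone_normalSupport hne, ?_⟩, ?_⟩, hP, ?_, ?_⟩
  · rw [hunion]
    exact Set.iUnion₂_mono hcell
  · rintro K ⟨hK, hKU⟩ hPK
    rw [hunion] at hKU
    obtain ⟨P', h', hvert, hsupp⟩ := h.exists_normalSupport_eq hv hK hPK hKU
    have hne' : (vertexSet P').Nonempty := h'.1.2.1
    have heq := hrec P' h' hvert fun u hu => by
      rw [hP.mem_recessionCone_iff_normalSupport hne]
      rw [h'.1.1.mem_recessionCone_iff_normalSupport hne', hsupp] at hu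
      exact fun μ hμ => hu μ (hPK hμ)
    intro μ hμ
    rw [hP.mem_normalSupport_iff hne, ← heq, ← h'.1.1.mem_normalSupport_iff hne', hsupp]
    exact hμ
  · refine Set.Subset.antisymm (fun γ hγ => ⟨hrange ▸ hγ, ?_⟩) fun γ hγ => ?_
    · exact (hP.interior_normalCone_nonempty hγ).mono (interior_mono (hsub γ hγ))
    · rw [hrange]
      exact hγ.1
  · refine fun γ hγ => (hsub γ hγ).antisymm ?_
    rintro μ ⟨hμ, hμP⟩
    rw [hcone γ hγ] at hμ
    obtain ⟨γ', hγ', hμ'⟩ := Set.mem_iUnion₂.1 hμP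
    exact fun x hx => ((mem_cell_iff.1 hμ).2.1 γ' hγ').trans (hμ' x hx)

theorem IsLocalCompatibleSystem.isMinimalLocalSolution [FiniteDimensional ℝ E] (hφ : φ.IsGeneric)
    (hv : v ∈ vertexSet φ.coeffSum) {t : ℕ} {C : Fin t → Set (StrongDual ℝ E)}
    {i j : Fin t → ℕ} (hsys : φ.IsLocalCompatibleSystem v C i j)
    (hrange : vertexSet P = Set.range (fun k => φ.rho v (i k) (j k)))
    {L : Set (StrongDual ℝ E)} (hL : IsMaximalPolyhedralSubcone (⋃ k, C k) L)
    (hP : φ.IsAssociatedPolyhedron v C i j L P) : φ.IsMinimalLocalSolution v P := by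
  obtain ⟨hPoly, -, hnormal⟩ := hP
  have hcone : ∀ γ ∈ vertexSet P, φ.coneAt v C i j γ = φ.cell v (vertexSet P) γ := by
    intro γ hγ
    rw [hrange] at hγ ⊢
    exact hsys.coneAt_eq_cell hφ hv hγ
  have hunion : ⋃ k, C k = ⋃ γ ∈ vertexSet P, φ.cell v (vertexSet P) γ := by
    rw [iUnion_eq_biUnion_coneAt (φ := φ) (v := v) C i j, ← hrange]
    exact Set.iUnion₂_congr hcone
  have hne : (vertexSet P).Nonempty := by
    rw [hrange]
    exact ⟨_, ⟨0, hsys.pos⟩, rfl⟩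
  have hsupp : normalSupport P = L := by
    refine Set.Subset.antisymm (Set.iUnion₂_subset fun γ hγ => ?_) fun μ hμ => ?_
    · rw [hnormal γ hγ]
      exact Set.inter_subset_right
    · have hμU := hL.1.2 hμ
      rw [hunion] at hμU
      obtain ⟨γ, hγ, hμγ⟩ := Set.mem_iUnion₂.1 hμU
      refine normalCone_subset_normalSupport hγ ?_
      rw [hnormal γ hγ, hcone γ hγ]
      exact ⟨hμγ, hμ⟩
  refine ⟨isLocalSolution_of_normalCone_subset_cell hv hPoly hne ?_ fun γ hγ => ?_, ?_⟩
  · rw [hrange]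
    exact hsys.range_subset_rhoSet
  · rw [hnormal γ hγ, hcone γ hγ]
    exact Set.inter_subset_left
  · intro P' h' hvert hrec
    have hne' : (vertexSet P').Nonempty := h'.1.2.1
    refine hrec.antisymm fun u hu => ?_
    have hLP' : L ⊆ normalSupport P' := by
      rw [← hsupp]
      intro μ hμ
      rw [hPoly.mem_normalSupport_iff hne] at hμ
      rw [h'.1.1.mem_normalSupport_iff hne']
      exact fun u hu => hμ u (hrec hu)
    have hP'L : normalSupport P' ⊆ L := by
      refine hL.2 ⟨h'.1.1.isPolyhedralCone_normalSupport hne', ?_⟩ hLP'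
      rw [hunion, ← hvert]
      exact Set.iUnion₂_mono fun γ hγ => h'.normalCone_subset_cell hφ hv hγ
    rw [h'.1.1.mem_recessionCone_iff_normalSupport hne']
    rw [hPoly.mem_recessionCone_iff_normalSupport hne, hsupp] at hu
    exact fun μ hμ => hu μ (hP'L hμ)

end PolyhedralPolynomial

end Polyhedral

theorem theorem1p1 {n : ℕ}
    (φ : Polyhedral.PolyhedralPolynomial (EuclideanSpace ℝ (Fin n))) (hφ : φ.IsGeneric)
    (v : EuclideanSpace ℝ (Fin n)) (hv : v ∈ Polyhedral.vertexSet φ.coeffSum)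
    (P₀ : Set (EuclideanSpace ℝ (Fin n))) (hP₀ : Polyhedral.IsPolyhedron P₀)
    (V : Set (EuclideanSpace ℝ (Fin n))) (hV : Polyhedral.vertexSet P₀ = V) :
    φ.IsMinimalLocalSolution v P₀ ↔
      ∃ (t : ℕ) (C : Fin t → Set (StrongDual ℝ (EuclideanSpace ℝ (Fin n))))
        (i j : Fin t → ℕ),
        φ.IsLocalCompatibleSystem v C i j ∧
        V = Set.range (fun k => φ.rho v (i k) (j k)) ∧
        ∃ L : Set (StrongDual ℝ (EuclideanSpace ℝ (Fin n))),
          Polyhedral.PolyhedralPolynomial.IsMaximalPolyhedralSubcone (⋃ k, C k) L ∧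
          φ.IsAssociatedPolyhedron v C i j L P₀ := by
  subst hV
  constructor
  · exact fun h => h.exists_isLocalCompatibleSystem hφ hv
  · rintro ⟨t, C, i, j, hsys, hrange, L, hL, hP⟩
    exact hsys.isMinimalLocalSolution hφ hv hrange hL hP
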